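/- Let $n\ge 2$, let $f_1,\dots,f_{n-1}$ be real functions of one real variable, and put $\mathbf f(x)=(x,f_1(x),\dots,f_{n-1}(x))$. Suppose that $\mathbf f$ is non-degenerate at a point $x_0\in\mathbb R$, that is, for some $l_0\in\mathbb N$ the map $\mathbf f$ is $l_0$ times continuously differentiable on a ball centred at $x_0$ and the derivatives $\mathbf f^{(i)}(x_0)$, $1\le i\le l_0$, span $\mathbb R^n$. Let $G(x)$ be the $(n+1)\times(n+1)$ matrix whose $i$-th row, for $1\le i\le n-1$, has entries $f_i(x)-xf_i'(x)$ and $f_i'(x)$ in columns $1$ and $2$, entry $-1$ in column $i+2$ and $0$ elsewhere, whose $n$-th row is $(x,-1,0,\dots,0)$ and whose $(n+1)$-st row is $(1,0,0,\dots,0)$. For $I\subset\{1,\dots,n+1\}$ with $\#I=r$ and an $(n+1)\times r$ matrix $\Gamma$, let $G_I(x)$ be the matrix formed by the rows of $G(x)$ with indices in $I$ (in increasing order), and put $\phi_{I,\Gamma}(x)=\det(G_I(x)\Gamma)$. A continuous function $g:V\to\mathbb R$ on an open set $V\subset\mathbb R$ is called $(C,\alpha)$-good on $V$ if $|\{x\in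 J:|g(x)|<\varepsilon\sup_J|g|\}|\le C\varepsilon^\alpha|J|$ for every bounded non-empty open interval $J\subset V$ and every $\varepsilon>0$, where $|\cdot|$ of a set is Lebesgue measure. For an interval $B$ with centre $c$ and half-length $s>0$, and $\lambda>0$, let $\lambda B$ be the open interval $(c-\lambda s,c+\lambda s)$. Then there exist an open interval $U$ centred at $x_0$, an integer $l\ge1$ and a constant $C>0$ such that for every interval $B\subset U$ of positive length there is a constant $\rho_B>0$ with the following two properties for every $1\le r\le n$ and every integer $(n+1)\times r$ matrix $\Gamma$ of rank $r$: (i) for every $I\subset\{1,\dots,n+1\}$ with $\#I=r$, the function $|\phi_{I,\Gamma}|$ is $\left(C,\frac1{2l-1}\right)$-good on $3^{n+1}B$; (ii) for some $I\subset\{1,\dots,\max\{r,n-1\}\}$ with $\#I=r$, $\ \sup_{x\in B}|\phi_{I,\Gamma}(x)|\ge\rho_B$. -/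

import Mathlib

open MeasureTheory
open scoped ENNReal

noncomputable section

/-- A map `g` from (a neighbourhood of `x₀` in) `ℝ` to `ℝⁿ` is `l`-non-degenerate at `x₀` if it is
`l` times continuously differentiable on some ball centred at `x₀` and its derivatives of orders
`1, …, l` at `x₀` span `ℝⁿ`. -/
def IsNondegenerateOfOrderAt {n : ℕ} (l : ℕ) (g : ℝ → Fin n → ℝ) (x₀ : ℝ) : Prop :=
  (∃ δ > 0, ContDiffOn ℝ l g (Metric.ball x₀ δ)) ∧
    Submodule.span ℝ {v | ∃ i : ℕ, 1 ≤ i ∧ i ≤ l ∧ v = iteratedDeriv i g x₀} = ⊤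

/-- `g` is non-degenerate at `x₀` if it is `l`-non-degenerate there for some `l`. -/
def IsNondegenerateAt {n : ℕ} (g : ℝ → Fin n → ℝ) (x₀ : ℝ) : Prop :=
  ∃ l : ℕ, IsNondegenerateOfOrderAt l g x₀

/-- The curve `x ↦ (x, f₁(x), …, f_m(x))` in `ℝ^{m+1}`. -/
def mongeCurve {m : ℕ} (f : Fin m → ℝ → ℝ) (x : ℝ) : Fin (m + 1) → ℝ :=
  Matrix.vecCons x (fun i => f i x)

/-- `sup_{x ∈ S} |g(x)|`, as an element of `[0, ∞]`. -/
def supAbs (g : ℝ → ℝ) (S : Set ℝ) : ℝ≥0∞ :=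
  ⨆ x ∈ S, ‖g x‖ₑ

/-- `g` is (continuous and) `(C, α)`-good on `V ⊆ ℝ`: for every open interval `J ⊆ V` and every
`ε > 0`, `|{x ∈ J : |g(x)| < ε sup_J |g|}| ≤ C ε^α |J|`. -/
def IsGoodOn (C α : ℝ) (g : ℝ → ℝ) (V : Set ℝ) : Prop :=
  ContinuousOn g V ∧
    ∀ c s : ℝ, 0 < s → Metric.ball c s ⊆ V → ∀ ε : ℝ, 0 < ε →
      volume {x ∈ Metric.ball c s | ‖g x‖ₑ < ENNReal.ofReal ε * supAbs g (Metric.ball c s)}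
        ≤ ENNReal.ofReal (C * ε ^ α) * volume (Metric.ball c s)

/-- The `(m+2) × (m+2)` matrix `G(x)`. Its first `m` rows are
`(fᵢ - x fᵢ', fᵢ', 0, …, -1, …, 0)`, with `-1` in column `i + 2` (counting from one), and its
last two rows are `(x, -1, 0, …, 0)` and `(1, 0, 0, …, 0)`. -/
def gMatrix {m : ℕ} (f : Fin m → ℝ → ℝ) (x : ℝ) : Matrix (Fin (m + 2)) (Fin (m + 2)) ℝ :=
  Matrix.of (Fin.append
    (fun i : Fin m =>
      (Matrix.vecCons (f i x - x * deriv (f i) x)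
        (Matrix.vecCons (deriv (f i) x) (fun j : Fin m => if j = i then -1 else 0)) :
        Fin (m + 2) → ℝ))
    ![(Matrix.vecCons x (Matrix.vecCons (-1) (fun _ : Fin m => 0)) : Fin (m + 2) → ℝ),
      (Matrix.vecCons 1 (Matrix.vecCons 0 (fun _ : Fin m => 0)) : Fin (m + 2) → ℝ)])

/-- `φ_{I,Γ}(x) = det (G_I(x) Γ)`, where `G_I(x)` is formed by the rows of `G(x)` with indices in
the `r`-element set `I`, given by its increasing enumeration. -/
def minorFn {m r : ℕ} (f : Fin m → ℝ → ℝ) (I : Fin r ↪o Fin (m + 2))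
    (Γ : Matrix (Fin (m + 2)) (Fin r) ℤ) (x : ℝ) : ℝ :=
  ((gMatrix f x).submatrix I id * Γ.map (Int.cast : ℤ → ℝ)).det

/-- The integer matrix `Γ` with `r` columns has rank `r`. -/
def HasFullColumnRank {k r : ℕ} (Γ : Matrix (Fin k) (Fin r) ℤ) : Prop :=
  (Γ.map (Int.cast : ℤ → ℝ)).rank = r

/-- `B` is an interval (open, closed or half-open) with centre `c` and half-length `s`. -/
def IsIntervalAround (B : Set ℝ) (c s : ℝ) : Prop :=
  Metric.ball c s ⊆ B ∧ B ⊆ Metric.closedBall c s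

end

open Filter Topology Metric

/-! Put `m = n - 1` and let `c = (1, x, f₁, …, f_m)` be the lifted curve. The proof turns every
minor into one of two kinds of function of `c`, and then shows that such functions look like nonzero
polynomials of bounded degree on every small interval, with constants independent of the interval
and of the coefficients.

Algebra. A Schur complement identifies `det (G_I Γ)`, up to sign, with the determinant of a matrix
`[y z K]`: the columns of `K` are selected entries of those of `Γ`, padded with zeros, while `y` and
`z` are the same selections of `c` and `c'` up to constant corrections (`abs_minorFn_eq`). As a
function of `(y, z)` this is a decomposable alternating form `(α ⬝ y)(β ⬝ z) - (α ⬝ z)(β ⬝ y)`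
(`exists_borderedDet_eq`). Hence each minor is, up to sign, a linear combination of the components
of `c` or a Wronskian of two such combinations (`exists_abs_minorFn_eq`).

Analysis. Non-degeneracy says that the jet at `x₀` determines the coefficients, and this persists
nearby with a uniform bound. After rescaling an interval to `(-1, 1)` and normalising the Taylor
coefficients, a combination is uniformly `C¹`-close to a unit polynomial, and a Wronskian, after
Gram–Schmidt, to that of an orthonormal pair. Compactness makes sublevel sets of these model
functions uniformly small (`exists_polyEval_bounds`), so the originals are comparable to a number
`κ` on at least half of each interval (`exists_isSpreadOn`).

Conclusion. Such a half-measure bound on all subintervals, iterated over components of sublevel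
sets, gives a power law (`isGoodOn_of_one_scale`). For the lower bound, integrality of `Γ` forces
some coordinate of the alternating form to be at least one in absolute value
(`exists_one_le_abs_coord`). With suitable rows this is a coefficient, or a 2 × 2 minor of
coefficients, and it bounds `κ` from below in terms of the interval alone. -/

/-! ### Suprema on intervals, and goodness from a single scale -/

lemma enorm_le_supAbs {g : ℝ → ℝ} {S : Set ℝ} {x : ℝ} (hx : x ∈ S) : ‖g x‖ₑ ≤ supAbs g S :=
  le_iSup₂ (f := fun x (_ : x ∈ S) => ‖g x‖ₑ) x hx

lemma supAbs_mono {g : ℝ → ℝ} {S T : Set ℝ} (h : S ⊆ T) : supAbs g S ≤ supAbs g T :=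
  iSup₂_le fun _ hx => enorm_le_supAbs (h hx)

lemma enorm_le_supAbs_of_mem_closure {g : ℝ → ℝ} {S : Set ℝ} {p : ℝ} (hp : p ∈ closure S)
    (hg : ContinuousAt g p) : ‖g p‖ₑ ≤ supAbs g S := by
  have := mem_closure_iff_nhdsWithin_neBot.1 hp
  refine le_of_tendsto (x := 𝓝[S] p) (hg.enorm.mono_left nhdsWithin_le_nhds) ?_
  filter_upwards [self_mem_nhdsWithin] with x hx using enorm_le_supAbs hx

lemma exists_eq_ball_of_isOpen_of_isConnected {S : Set ℝ} (ho : IsOpen S) (hc : IsConnected S)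
    (hb : Bornology.IsBounded S) : ∃ c s : ℝ, 0 < s ∧ S = ball c s := by
  have h1 := hc.Ioo_csInf_csSup_subset hb.bddBelow hb.bddAbove
  have h2 : S ⊆ Set.Ioo (sInf S) (sSup S) := by
    have : S ⊆ Set.Icc (sInf S) (sSup S) := 
      fun x hx => ⟨csInf_le hb.bddBelow hx, le_csSup hb.bddAbove hx⟩
    simpa [interior_Icc] using (ho.subset_interior_iff).2 this
  have h3 := h2.antisymm h1
  obtain ⟨x, hx⟩ := hc.nonempty
  have hx' := h2 hx
  refine ⟨(sInf S + sSup S) / 2, (sSup S - sInf S) / 2, by linarith [hx'.1, hx'.2], ?_⟩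
  rw [← Real.Ioo_eq_ball]; exact h3

/-- A one-scale bound for the sublevel sets on all subintervals improves by a factor two each time
the level is multiplied by `ε₀`. -/
lemma volume_sublevel_mul_le {g : ℝ → ℝ} {c s ε₀ : ℝ} (hg : ContinuousOn g (ball c s))
    (hε₁ : ε₀ ≤ 1)
    (H : ∀ c' s', 0 < s' → ball c' s' ⊆ ball c s →
      volume {x ∈ ball c' s' | ‖g x‖ₑ < ENNReal.ofReal ε₀ * supAbs g (ball c' s')}
        ≤ ENNReal.ofReal s')
    {τ : ℝ≥0∞} (hτ : τ ≤ supAbs g (ball c s)) :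
    volume {x ∈ ball c s | ‖g x‖ₑ < ENNReal.ofReal ε₀ * τ}
      ≤ 2⁻¹ * volume {x ∈ ball c s | ‖g x‖ₑ < τ} := by
  set E : Set ℝ := {x ∈ ball c s | ‖g x‖ₑ < τ} with hE
  set E' : Set ℝ := {x ∈ ball c s | ‖g x‖ₑ < ENNReal.ofReal ε₀ * τ} with hE'
  have hcont : ContinuousOn (fun x => ‖g x‖ₑ) (ball c s) := hg.enorm
  have hEo : IsOpen E := hcont.isOpen_inter_preimage isOpen_ball isOpen_Iio
  have hE'o : IsOpen E' := hcont.isOpen_inter_preimage isOpen_ball isOpen_Iio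
  have hsub : E' ⊆ E := fun x hx => ⟨hx.1, hx.2.trans_le (by
    calc ENNReal.ofReal ε₀ * τ ≤ 1 * τ := by gcongr; simpa using hε₁
      _ = τ := one_mul _)⟩
  set T : Set (Set ℝ) := {C | ∃ x ∈ E, C = connectedComponentIn E x} with hT
  have hTE : ∀ C ∈ T, C ⊆ E := by
    rintro _ ⟨x, hx, rfl⟩; exact connectedComponentIn_subset _ _
  have hTo : ∀ C ∈ T, IsOpen C := by rintro _ ⟨x, hx, rfl⟩; exact hEo.connectedComponentIn
  have hTn : ∀ C ∈ T, C.Nonempty := by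
    rintro _ ⟨x, hx, rfl⟩; exact ⟨x, mem_connectedComponentIn hx⟩
  have hTd : T.PairwiseDisjoint id := by
    rintro _ ⟨x, hx, rfl⟩ _ ⟨y, hy, rfl⟩ hne
    refine Set.disjoint_left.2 fun z hz hz' => hne ?_
    rw [connectedComponentIn_eq hz, connectedComponentIn_eq hz']
  have hTc : T.Countable := hTd.countable_of_isOpen hTo hTn
  have hTU : E = ⋃ C ∈ T, C := by
    refine Set.Subset.antisymm (fun x hx => ?_) (Set.iUnion₂_subset hTE)
    exact Set.mem_iUnion₂.2 ⟨_, ⟨x, hx, rfl⟩, mem_connectedComponentIn hx⟩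
  have key : ∀ C ∈ T, volume (E' ∩ C) ≤ 2⁻¹ * volume C := by
    intro C hC
    have hCE := hTE C hC
    have hCJ : C ⊆ ball c s := fun x hx => (hCE hx).1
    have hCo := hTo C hC
    have hCn := hTn C hC
    have hCc : IsConnected C := by
      obtain ⟨x, hx, rfl⟩ := hC
      exact isConnected_connectedComponentIn_iff.2 hx
    have hmax : ∀ D, IsPreconnected D → C ⊆ D → D ⊆ E → D ⊆ C := by
      intro D hD hCD hDE
      obtain ⟨x, hx, rfl⟩ := hC
      exact hD.subset_connectedComponentIn (hCD (mem_connectedComponentIn hx)) hDE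
    -- Either the component fills the interval, and the hypothesis on `τ` applies, or it has a
    -- boundary point inside the interval. By maximality of the component that point lies outside
    -- `E`, so `|g| ≥ τ` there, and continuity passes this to the supremum over `C`.
    have hsup : τ ≤ supAbs g C := by
      by_cases hcl : closure C ∩ ball c s ⊆ C
      · have hJ : ball c s ⊆ C := by
          refine (convex_ball c s).isPreconnected.subset_of_closure_inter_subset hCo ?_ hcl
          obtain ⟨x, hx⟩ := hCn
          exact ⟨x, hCJ hx, hx⟩
        exact hτ.trans (supAbs_mono hJ)
      · obtain ⟨p, ⟨hp1, hp2⟩, hp3⟩ := Set.not_subset.1 hcl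
        have hpE : p ∉ E := by
          intro hpE
          refine hp3 (hmax (insert p C) ?_ (Set.subset_insert _ _)
            (Set.insert_subset hpE hCE) (Set.mem_insert _ _))
          exact hCc.isPreconnected.subset_closure (Set.subset_insert _ _)
            (Set.insert_subset hp1 subset_closure)
        have : τ ≤ ‖g p‖ₑ := by
          by_contra h
          exact hpE ⟨hp2, not_le.1 h⟩
        exact this.trans (enorm_le_supAbs_of_mem_closure hp1
          (hg.continuousAt (isOpen_ball.mem_nhds hp2)))
    obtain ⟨c', s', hs', hball⟩ := exists_eq_ball_of_isOpen_of_isConnected hCo hCc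
      (isBounded_ball.subset hCJ)
    have h1 := H c' s' hs' (hball ▸ hCJ)
    rw [← hball] at h1
    calc volume (E' ∩ C) ≤ volume {x ∈ C | ‖g x‖ₑ < ENNReal.ofReal ε₀ * supAbs g C} := by
          refine measure_mono fun x hx => ⟨hx.2, hx.1.2.trans_le ?_⟩
          gcongr
      _ ≤ ENNReal.ofReal s' := h1
      _ = 2⁻¹ * volume C := by
          rw [hball, Real.volume_ball, ENNReal.ofReal_mul (by norm_num), ← mul_assoc]
          simp [ENNReal.inv_mul_cancel]
  have hEv : volume E = ∑' C : T, volume (C : Set ℝ) := by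
    conv_lhs => rw [hTU]
    exact measure_biUnion hTc (f := id) hTd fun C hC => (hTo C hC).measurableSet
  calc volume E' = volume (⋃ C ∈ T, E' ∩ C) := by
        rw [← Set.inter_iUnion₂, ← hTU, Set.inter_eq_left.2 hsub]
    _ ≤ ∑' C : T, volume (E' ∩ C) := measure_biUnion_le _ hTc _
    _ ≤ ∑' C : T, 2⁻¹ * volume (C : Set ℝ) := ENNReal.tsum_le_tsum fun C => key C C.2
    _ = 2⁻¹ * volume E := by rw [ENNReal.tsum_mul_left, hEv]

/-- A one-scale bound for the sublevel sets on all subintervals implies goodness. -/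
lemma isGoodOn_of_one_scale {g : ℝ → ℝ} {V : Set ℝ} {l : ℕ} (hl : 1 ≤ l)
    (hg : ContinuousOn g V)
    (H : ∀ c s, 0 < s → ball c s ⊆ V →
      volume {x ∈ ball c s | ‖g x‖ₑ < ENNReal.ofReal ((1 / 2) ^ (2 * l - 1)) *
        supAbs g (ball c s)} ≤ ENNReal.ofReal s) :
    IsGoodOn 2 (1 / (2 * (l : ℝ) - 1)) g V := by
  refine ⟨hg, fun c s hs hV ε hε => ?_⟩
  set ε₀ : ℝ := (1 / 2) ^ (2 * l - 1) with hε₀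
  set α : ℝ := 1 / (2 * (l : ℝ) - 1) with hα
  have hl' : (1 : ℝ) ≤ l := by exact_mod_cast hl
  have hα0 : 0 < α := by rw [hα]; apply one_div_pos.2; linarith
  have hε₀0 : 0 < ε₀ := by positivity
  have hε₀1 : ε₀ < 1 := pow_lt_one₀ (by norm_num) (by norm_num) (by omega)
  -- The exponents `2l - 1` and `1 / (2l - 1)` cancel, so a factor `ε₀` in the level costs exactly a
  -- factor `1 / 2` in measure.
  have hε₀α : ε₀ ^ α = 1 / 2 := by
    rw [hε₀, ← Real.rpow_natCast, ← Real.rpow_mul (by norm_num), hα,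
      Nat.cast_sub (by omega)]
    push_cast
    rw [mul_one_div_cancel (by linarith), Real.rpow_one]
  rcases le_or_gt 1 ε with h1 | h1
  · calc _ ≤ volume (ball c s) := measure_mono fun x hx => hx.1
      _ = 1 * volume (ball c s) := (one_mul _).symm
      _ ≤ _ := by
        gcongr
        rw [ENNReal.one_le_ofReal]
        linarith [Real.one_le_rpow h1 hα0.le]
  have iter : ∀ k : ℕ, volume {x ∈ ball c s | ‖g x‖ₑ < ENNReal.ofReal (ε₀ ^ k) *
      supAbs g (ball c s)} ≤ ENNReal.ofReal ((1 / 2) ^ k) * volume (ball c s) := by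
    intro k
    induction k with
    | zero =>
      simp only [pow_zero, ENNReal.ofReal_one, one_mul]
      exact measure_mono fun x hx => hx.1
    | succ k ih =>
      have hτ : ENNReal.ofReal (ε₀ ^ k) * supAbs g (ball c s) ≤ supAbs g (ball c s) := by
        calc _ ≤ 1 * supAbs g (ball c s) := by
              gcongr; simpa using pow_le_one₀ hε₀0.le hε₀1.le
          _ = _ := one_mul _
      have := volume_sublevel_mul_le (hg.mono hV) hε₀1.le
        (fun c' s' hs' h => H c' s' hs' (h.trans hV)) hτ
      rw [← mul_assoc, ← ENNReal.ofReal_mul hε₀0.le, ← pow_succ'] at this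
      calc _ ≤ _ := this
        _ ≤ 2⁻¹ * (ENNReal.ofReal ((1 / 2) ^ k) * volume (ball c s)) := by gcongr
        _ = _ := by
          rw [← mul_assoc, pow_succ', ENNReal.ofReal_mul (by norm_num)]
          congr 2
          rw [one_div, ENNReal.ofReal_inv_of_pos (by norm_num)]
          simp
  -- Rounding `ε` up to a power of `ε₀` loses one halving, which is where the constant `2` comes
  -- from.
  obtain ⟨k, hk1, hk2⟩ := exists_nat_pow_near_of_lt_one hε h1.le hε₀0 hε₀1
  calc _ ≤ volume {x ∈ ball c s | ‖g x‖ₑ < ENNReal.ofReal (ε₀ ^ k) * supAbs g (ball c s)} := by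
        refine measure_mono fun x hx => ⟨hx.1, hx.2.trans_le ?_⟩
        gcongr
    _ ≤ _ := iter k
    _ ≤ _ := by
      gcongr
      have h2 : (1 / 2 : ℝ) ^ (k + 1) ≤ ε ^ α := by
        calc (1 / 2 : ℝ) ^ (k + 1) = (ε₀ ^ (k + 1)) ^ α := by
              rw [← hε₀α, ← Real.rpow_natCast, ← Real.rpow_natCast, ← Real.rpow_mul hε₀0.le,
                ← Real.rpow_mul hε₀0.le, mul_comm]
          _ ≤ ε ^ α := Real.rpow_le_rpow (by positivity) hk1.le hα0.le
      rw [pow_succ] at h2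
      linarith

/-! ### Uniform sublevel bounds for polynomials and their Wronskians -/

lemma volume_setOf_eval_eq_zero {p : Polynomial ℝ} (hp : p ≠ 0) :
    volume {t : ℝ | p.eval t = 0} = 0 :=
  (Set.Finite.subset p.roots.toFinset.finite_toSet fun t ht => by
    simpa [hp] using ht).measure_zero _

/-- Dividing both polynomials by their gcd `g` divides the Wronskian by `g ^ 2`. Coprime polynomials
with zero Wronskian have zero derivatives, hence are constants in characteristic zero. -/
lemma Polynomial.exists_eq_C_mul_of_wronskian_eq_zero {a b : Polynomial ℝ}
    (h : a.wronskian b = 0) (ha : a ≠ 0) : ∃ t : ℝ, b = Polynomial.C t * a := by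
  set g := EuclideanDomain.gcd a b with hg
  have hg0 : g ≠ 0 := fun h0 => ha (EuclideanDomain.gcd_eq_zero_iff.1 h0).1
  obtain ⟨a', ha'⟩ := EuclideanDomain.gcd_dvd_left a b
  obtain ⟨b', hb'⟩ := EuclideanDomain.gcd_dvd_right a b
  rw [← hg] at ha' hb'
  have hcop : IsCoprime a' b' := by
    refine ⟨EuclideanDomain.gcdA a b, EuclideanDomain.gcdB a b, mul_left_cancel₀ hg0 ?_⟩
    have := EuclideanDomain.gcd_eq_gcd_ab a b
    rw [← hg] at this
    nth_rewrite 2 [this]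
    nth_rewrite 3 [ha']
    nth_rewrite 4 [hb']
    ring
  have hw : a'.wronskian b' = 0 := by
    have : a.wronskian b = g ^ 2 * a'.wronskian b' := by
      rw [ha', hb']
      simp only [Polynomial.wronskian, Polynomial.derivative_mul]
      ring
    rw [this] at h
    exact (mul_eq_zero.1 h).resolve_left (pow_ne_zero _ hg0)
  obtain ⟨h1, h2⟩ := hcop.wronskian_eq_zero_iff.1 hw
  obtain ⟨u, rfl⟩ := Polynomial.natDegree_eq_zero.1
    (Polynomial.derivative_eq_zero.1 h1)
  obtain ⟨v, rfl⟩ := Polynomial.natDegree_eq_zero.1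
    (Polynomial.derivative_eq_zero.1 h2)
  have hu : u ≠ 0 := by rintro rfl; simp at ha'; exact ha ha'
  refine ⟨v / u, ?_⟩
  rw [ha', hb', mul_left_comm, ← Polynomial.C_mul, div_mul_cancel₀ _ hu]

/-- The sublevel sets of a continuous family of functions whose zero sets are null are uniformly
small. -/
lemma IsCompact.exists_volume_sublevel_le {X : Type*} [TopologicalSpace X] {K : Set X}
    (hK : IsCompact K) {W : X → ℝ → ℝ} (hW : Continuous (Function.uncurry W))
    (h0 : ∀ k ∈ K, volume {t : ℝ | W k t = 0} = 0) :
    ∃ ε : ℝ, 0 < ε ∧ ∀ k ∈ K, volume {t ∈ ball (0 : ℝ) 1 | |W k t| < ε} ≤ 1 := by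
  refine hK.induction_on (p := fun S => ∃ ε : ℝ, 0 < ε ∧ ∀ k ∈ S,
    volume {t ∈ ball (0 : ℝ) 1 | |W k t| < ε} ≤ 1) ⟨1, one_pos, by simp⟩ ?_ ?_ ?_
  · rintro s t hst ⟨ε, hε, h⟩
    exact ⟨ε, hε, fun k hk => h k (hst hk)⟩
  · rintro s t ⟨ε, hε, h⟩ ⟨ε', hε', h'⟩
    refine ⟨min ε ε', lt_min hε hε', fun k hk => ?_⟩
    rcases hk with hk | hk
    · refine (measure_mono ?_).trans (h k hk)
      exact fun x hx => ⟨hx.1, hx.2.trans_le (min_le_left _ _)⟩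
    · refine (measure_mono ?_).trans (h' k hk)
      exact fun x hx => ⟨hx.1, hx.2.trans_le (min_le_right _ _)⟩
  -- At a single parameter the sublevel sets decrease to a null set, so one of them has measure
  -- below `1`, half the length of `(-1, 1)`. For nearby parameters `W` moves by less than `ε / 2`
  -- uniformly on `[-1, 1]`, so the level `ε / 2` works there.
  · intro k hk
    have hWk : Continuous (W k) := hW.comp (Continuous.prodMk_right k)
    let S : ℕ → Set ℝ := fun n => {t ∈ ball (0 : ℝ) 1 | |W k t| < 1 / ((n : ℝ) + 1)}
    have hSo : ∀ n, IsOpen (S n) := fun n =>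
      isOpen_ball.inter (isOpen_lt hWk.abs continuous_const)
    have hSa : Antitone S := fun i j hij t ht =>
      ⟨ht.1, ht.2.trans_le (Nat.one_div_le_one_div hij)⟩
    have hlim := tendsto_measure_iInter_atTop (μ := volume) (s := S)
      (fun n => (hSo n).measurableSet.nullMeasurableSet) hSa
      ⟨0, ((measure_mono (fun t ht => ht.1)).trans_lt
        (measure_ball_lt_top (μ := volume) (x := (0 : ℝ)) (r := 1))).ne⟩
    have hz : volume (⋂ n, S n) = 0 := by
      refine measure_mono_null (fun t ht => ?_) (h0 k hk)
      by_contra hne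
      obtain ⟨n, hn⟩ := exists_nat_one_div_lt (abs_pos.2 hne)
      exact absurd (Set.mem_iInter.1 ht n).2 (not_lt.2 hn.le)
    rw [hz] at hlim
    obtain ⟨n, hn⟩ := (hlim.eventually (gt_mem_nhds (zero_lt_one))).exists
    set ε : ℝ := 1 / ((n : ℝ) + 1) with hε
    have hε0 : 0 < ε := by positivity
    have hev : ∀ᶠ k' in 𝓝 k, ∀ t ∈ closedBall (0 : ℝ) 1, |W k' t - W k t| < ε / 2 := by
      refine (isCompact_closedBall (0 : ℝ) 1).eventually_forall_of_forall_eventually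
        (P := fun k' t => |W k' t - W k t| < ε / 2) fun t _ => ?_
      have hc : Continuous fun z : X × ℝ => |W z.1 z.2 - W k z.2| :=
        (hW.sub (hWk.comp continuous_snd)).abs
      have := hc.tendsto (k, t)
      simp only [sub_self, abs_zero] at this
      exact this.eventually (gt_mem_nhds (half_pos hε0))
    refine ⟨_, mem_nhdsWithin_of_mem_nhds hev, ε / 2, half_pos hε0, fun k' hk' => ?_⟩
    refine (measure_mono ?_).trans hn.le
    refine fun t ht => ⟨ht.1, ?_⟩
    have h1 := hk' t (ball_subset_closedBall ht.1)
    have h2 := ht.2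
    rw [abs_lt] at h1 h2
    show |W k t| < ε
    rw [abs_lt]; constructor <;> linarith

/-- Rescaling an interval to `(-1, 1)`. -/
lemma volume_ball_sep_eq {y s : ℝ} (hs : 0 < s) (p : ℝ → Prop) :
    volume {x ∈ ball y s | p x} =
      ENNReal.ofReal s * volume {t ∈ ball (0 : ℝ) 1 | p (y + s * t)} := by
  have h : {t ∈ ball (0 : ℝ) 1 | p (y + s * t)} =
      (s * ·) ⁻¹' ((fun x => y + x) ⁻¹' {x ∈ ball y s | p x}) := by
    ext t
    simp only [Set.mem_preimage, Set.mem_ofPred_eq, mem_ball, Real.dist_eq, add_sub_cancel_left,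
      abs_mul, abs_of_pos hs, sub_zero]
    rw [mul_lt_iff_lt_one_right hs]
  rw [h, Real.volume_preimage_mul_left hs.ne', measure_preimage_add, ← mul_assoc,
    ← ENNReal.ofReal_mul hs.le, abs_of_pos (inv_pos.2 hs), mul_inv_cancel₀ hs.ne']
  simp

/-- The polynomial function with coefficient vector `v`. -/
noncomputable def polyEval {d : ℕ} (v : EuclideanSpace ℝ (Fin d)) (t : ℝ) : ℝ := ∑ i, v i * t ^ (i : ℕ)

/-- The derivative of the polynomial function with coefficient vector `v`. -/
noncomputable def polyDeriv {d : ℕ} (v : EuclideanSpace ℝ (Fin d)) (t : ℝ) : ℝ :=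
  ∑ i, v i * ((i : ℕ) * t ^ ((i : ℕ) - 1))

/-- The polynomial with coefficient vector `v`. -/
noncomputable def coeffPoly {d : ℕ} (v : EuclideanSpace ℝ (Fin d)) : Polynomial ℝ :=
  ∑ i, Polynomial.C (v i) * Polynomial.X ^ (i : ℕ)

lemma eval_coeffPoly {d : ℕ} (v : EuclideanSpace ℝ (Fin d)) (t : ℝ) :
    (coeffPoly v).eval t = polyEval v t := by
  simp [coeffPoly, polyEval, Polynomial.eval_finsetSum]

lemma eval_derivative_coeffPoly {d : ℕ} (v : EuclideanSpace ℝ (Fin d)) (t : ℝ) :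
    (coeffPoly v).derivative.eval t = polyDeriv v t := by
  simp [coeffPoly, polyDeriv, Polynomial.eval_finsetSum, Polynomial.derivative_X_pow]

lemma coeff_coeffPoly {d : ℕ} (v : EuclideanSpace ℝ (Fin d)) (i : Fin d) :
    (coeffPoly v).coeff i = v i := by
  simp only [coeffPoly, Polynomial.finsetSum_coeff, Polynomial.coeff_C_mul_X_pow, Fin.val_inj]
  simp

lemma continuous_polyEval {d : ℕ} :
    Continuous fun z : EuclideanSpace ℝ (Fin d) × ℝ => polyEval z.1 z.2 := by
  unfold polyEval; fun_prop

lemma continuous_polyDeriv {d : ℕ} :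
    Continuous fun z : EuclideanSpace ℝ (Fin d) × ℝ => polyDeriv z.1 z.2 := by
  unfold polyDeriv; fun_prop

/-- Uniform bounds for normalised polynomials, and for Wronskians of orthonormal pairs. -/
lemma exists_polyEval_bounds (d : ℕ) : ∃ ε M : ℝ, 0 < ε ∧ 1 ≤ M ∧
    (∀ v : EuclideanSpace ℝ (Fin d), ‖v‖ = 1 →
      (∀ t ∈ ball (0 : ℝ) 1, |polyEval v t| ≤ M ∧ |polyDeriv v t| ≤ M) ∧
      volume {t ∈ ball (0 : ℝ) 1 | |polyEval v t| < ε} ≤ 1) ∧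
    (∀ v w : EuclideanSpace ℝ (Fin d), ‖v‖ = 1 → ‖w‖ = 1 → inner ℝ v w = 0 →
      volume {t ∈ ball (0 : ℝ) 1 |
        |polyEval v t * polyDeriv w t - polyDeriv v t * polyEval w t| < ε} ≤ 1) := by
  have hS : IsCompact (sphere (0 : EuclideanSpace ℝ (Fin d)) 1) := isCompact_sphere _ _
  have hv0 : ∀ v : EuclideanSpace ℝ (Fin d), ‖v‖ = 1 → coeffPoly v ≠ 0 := by
    intro v hv h
    have : v = 0 := by
      ext i
      rw [← coeff_coeffPoly v i, h]; simp
    simp [this] at hv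
  obtain ⟨ε₁, hε₁, H₁⟩ := hS.exists_volume_sublevel_le (W := polyEval) continuous_polyEval
    (fun v hv => by
      simp only [← eval_coeffPoly]
      exact volume_setOf_eval_eq_zero (hv0 v (by simpa using hv)))
  have hK : IsCompact ((sphere (0 : EuclideanSpace ℝ (Fin d)) 1 ×ˢ
      sphere (0 : EuclideanSpace ℝ (Fin d)) 1) ∩ {z | inner ℝ z.1 z.2 = 0}) :=
    (hS.prod hS).inter_right (isClosed_eq (continuous_fst.inner continuous_snd) continuous_const)
  obtain ⟨ε₂, hε₂, H₂⟩ := hK.exists_volume_sublevel_le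
    (W := fun z t => polyEval z.1 t * polyDeriv z.2 t - polyDeriv z.1 t * polyEval z.2 t)
    (by unfold Function.uncurry polyEval polyDeriv; fun_prop)
    (fun z hz => by
      obtain ⟨⟨hv, hw⟩, hvw⟩ := hz
      simp only [mem_sphere, dist_zero_right] at hv hw
      -- A vanishing Wronskian would make the two coefficient vectors proportional, contradicting
      -- orthonormality.
      have hne : (coeffPoly z.1).wronskian (coeffPoly z.2) ≠ 0 := by
        intro h
        obtain ⟨t, ht⟩ := Polynomial.exists_eq_C_mul_of_wronskian_eq_zero h (hv0 _ hv)
        have hzt : z.2 = t • z.1 := by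
          ext i
          rw [← coeff_coeffPoly z.2 i, ht, Polynomial.coeff_C_mul, coeff_coeffPoly]
          simp
        have hvw' : inner ℝ z.1 z.2 = 0 := hvw
        rw [hzt, inner_smul_right, real_inner_self_eq_norm_sq, hv] at hvw'
        have : t = 0 := by simpa using hvw'
        rw [hzt, this] at hw
        simp at hw
      have := volume_setOf_eval_eq_zero hne
      simpa only [Polynomial.wronskian, Polynomial.eval_sub, Polynomial.eval_mul,
        eval_coeffPoly, eval_derivative_coeffPoly] using this)
  obtain ⟨M₁, hM₁⟩ := (hS.prod (isCompact_closedBall (0 : ℝ) 1)).exists_bound_of_continuousOn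
    continuous_polyEval.continuousOn
  obtain ⟨M₂, hM₂⟩ := (hS.prod (isCompact_closedBall (0 : ℝ) 1)).exists_bound_of_continuousOn
    continuous_polyDeriv.continuousOn
  refine ⟨min ε₁ ε₂, max 1 (max M₁ M₂), lt_min hε₁ hε₂, le_max_left _ _, ?_, ?_⟩
  · intro v hv
    have hv' : v ∈ sphere (0 : EuclideanSpace ℝ (Fin d)) 1 := by simpa using hv
    refine ⟨fun t ht => ⟨?_, ?_⟩, ?_⟩
    · exact (hM₁ (v, t) ⟨hv', ball_subset_closedBall ht⟩).trans
        ((le_max_left _ _).trans (le_max_right _ _))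
    · exact (hM₂ (v, t) ⟨hv', ball_subset_closedBall ht⟩).trans
        ((le_max_right _ _).trans (le_max_right _ _))
    · refine (measure_mono ?_).trans (H₁ v hv')
      exact fun x hx => ⟨hx.1, hx.2.trans_le (min_le_left _ _)⟩
  · intro v w hv hw hvw
    refine (measure_mono ?_).trans (H₂ (v, w) ⟨⟨by simpa using hv, by simpa using hw⟩, hvw⟩)
    exact fun x hx => ⟨hx.1, hx.2.trans_le (min_le_right _ _)⟩

/-! ### Taylor approximation and stability of the jet map -/

/-- Taylor's formula with a remainder controlled by the oscillation of the top derivative. -/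
lemma abs_sub_taylor_le {L : ℕ} {g : ℝ → ℝ} {S : Set ℝ} (hS : IsOpen S)
    (hg : ContDiffOn ℝ L g S) {y s ω : ℝ} (hs : 0 < s) (hyS : ball y s ⊆ S)
    (hω : ∀ x ∈ ball y s, |iteratedDeriv L g x - iteratedDeriv L g y| ≤ ω) :
    ∀ x ∈ ball y s,
      |g x - ∑ i ∈ Finset.range (L + 1), iteratedDeriv i g y / (i.factorial : ℝ) * (x - y) ^ i|
        ≤ ω * s ^ L := by
  induction L generalizing g with
  | zero => simpa using hω
  | succ L ih =>
    intro x hx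
    have hω0 : 0 ≤ ω := (abs_nonneg _).trans (hω x hx)
    have hg' : DifferentiableOn ℝ g S ∧ ContDiffOn ℝ L (deriv g) S := by
      have h := hg
      push_cast at h
      rw [contDiffOn_succ_iff_deriv_of_isOpen hS] at h
      exact ⟨h.1, h.2.2⟩
    simp only [iteratedDeriv_succ'] at hω
    have ih' := ih hg'.2 hω
    set R : ℝ → ℝ := fun x => g x -
      ∑ i ∈ Finset.range (L + 2), iteratedDeriv i g y / (i.factorial : ℝ) * (x - y) ^ i with hR
    have hd : ∀ z ∈ ball y s, HasDerivAt R (deriv g z -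
        ∑ i ∈ Finset.range (L + 1),
          iteratedDeriv i (deriv g) y / (i.factorial : ℝ) * (z - y) ^ i) z := by
      intro z hz
      have h1 : HasDerivAt g (deriv g z) z :=
        (hg'.1.differentiableAt (hS.mem_nhds (hyS hz))).hasDerivAt
      have h2 : HasDerivAt (fun x => ∑ i ∈ Finset.range (L + 2),
          iteratedDeriv i g y / (i.factorial : ℝ) * (x - y) ^ i)
          (∑ i ∈ Finset.range (L + 2),
            iteratedDeriv i g y / (i.factorial : ℝ) * (i * (z - y) ^ (i - 1) * 1)) z :=
        HasDerivAt.fun_sum fun i _ => (((hasDerivAt_id z).sub_const y).pow i).const_mul _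
      refine (h1.sub h2).congr_deriv ?_
      congr 1
      rw [Finset.sum_range_succ' _ (L + 1)]
      simp only [Nat.cast_zero, zero_mul, mul_zero, add_zero, mul_one]
      refine Finset.sum_congr rfl fun i _ => ?_
      rw [iteratedDeriv_succ', Nat.factorial_succ, Nat.add_sub_cancel]
      push_cast
      field_simp
    have hRy : R y = 0 := by
      simp only [hR, Finset.sum_range_succ' _ (L + 1)]
      simp
    have hyb : y ∈ ball y s := mem_ball_self hs
    -- The remainder vanishes at `y` and its derivative is the remainder of `deriv g` of one order
    -- less, so the mean value inequality gains one factor `s`.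
    have hmv := (convex_ball y s).norm_image_sub_le_of_norm_hasDerivWithin_le
      (fun z hz => (hd z hz).hasDerivWithinAt) (fun z hz => ih' z hz) hyb hx
    rw [hRy, sub_zero, Real.norm_eq_abs, Real.norm_eq_abs] at hmv
    have hxy : |x - y| ≤ s := by rw [← Real.dist_eq]; exact (mem_ball.1 hx).le
    calc |R x| ≤ ω * s ^ L * |x - y| := hmv
      _ ≤ ω * s ^ L * s := by gcongr
      _ = ω * s ^ (L + 1) := by ring

lemma abs_deriv_sub_taylor_le {L : ℕ} {g : ℝ → ℝ} {S : Set ℝ} (hS : IsOpen S)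
    (hg : ContDiffOn ℝ (L + 1 : ℕ) g S) {y s ω : ℝ} (hs : 0 < s) (hyS : ball y s ⊆ S)
    (hω : ∀ x ∈ ball y s, |iteratedDeriv (L + 1) g x - iteratedDeriv (L + 1) g y| ≤ ω) :
    ∀ x ∈ ball y s,
      |deriv g x - ∑ i ∈ Finset.range (L + 1),
        iteratedDeriv (i + 1) g y / (i.factorial : ℝ) * (x - y) ^ i| ≤ ω * s ^ L := by
  push_cast at hg
  rw [contDiffOn_succ_iff_deriv_of_isOpen hS] at hg
  simp only [iteratedDeriv_succ'] at hω ⊢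
  exact abs_sub_taylor_le hS hg.2.2 hs hyS hω

/-- Injectivity of a matrix with continuous entries persists, with a uniform lower bound. -/
lemma eventually_exists_le_abs_sum {ι : Type*} [Fintype ι] {d : ℕ} {D : Fin (d + 1) → ι → ℝ → ℝ}
    {x₀ : ℝ} (hD : ∀ i k, ContinuousAt (D i k) x₀)
    (h0 : ∀ a : ι → ℝ, (∀ i, ∑ k, a k * D i k x₀ = 0) → a = 0) :
    ∃ c : ℝ, 0 < c ∧ ∀ᶠ y in 𝓝 x₀, ∀ a : ι → ℝ, ∃ i, c * ‖a‖ ≤ |∑ k, a k * D i k y| := by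
  set A : (ι → ℝ) →ₗ[ℝ] (Fin (d + 1) → ℝ) :=
    Matrix.mulVecLin (Matrix.of fun i k => D i k x₀) with hA
  have hAa : ∀ a i, A a i = ∑ k, a k * D i k x₀ := by
    intro a i
    simp only [hA, Matrix.mulVecLin_apply, Matrix.mulVec, dotProduct, Matrix.of_apply, mul_comm]
  have hker : LinearMap.ker A = ⊥ := by
    refine LinearMap.ker_eq_bot'.2 fun a ha => h0 a fun i => ?_
    rw [← hAa, ha]; rfl
  obtain ⟨K, hK, hKA⟩ := A.exists_antilipschitzWith hker
  have hK' : (0 : ℝ) < K := hK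
  have hlow : ∀ a, ‖a‖ ≤ K * ‖A a‖ := by
    intro a
    have := hKA.le_mul_dist a 0
    simpa using this
  set n : ℝ := (Fintype.card ι : ℝ) with hn
  have hn0 : 0 ≤ n := Nat.cast_nonneg _
  -- Moving from `x₀` to `y` costs at most half of the lower bound `‖a‖ / K` at `x₀`; with the
  -- quarter `1 / (4 * K)` assumed for contradiction, this stays below the whole.
  set η : ℝ := 1 / (2 * K * (n + 1)) with hη
  have hη0 : 0 < η := by positivity
  refine ⟨1 / (4 * K), by positivity, ?_⟩
  have hev : ∀ᶠ y in 𝓝 x₀, ∀ i k, |D i k y - D i k x₀| < η := by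
    refine eventually_all.2 fun i => eventually_all.2 fun k => ?_
    have := (hD i k).eventually (ball_mem_nhds _ hη0)
    simpa [Real.dist_eq] using this
  filter_upwards [hev] with y hy a
  by_contra! hcon
  have hpos : 0 < 1 / (4 * K) * ‖a‖ := (abs_nonneg _).trans_lt (hcon 0)
  have ha : 0 < ‖a‖ := by
    by_contra h
    have : ‖a‖ = 0 := le_antisymm (not_lt.1 h) (norm_nonneg _)
    simp [this] at hpos
  have hAi : ∀ i, ‖A a i‖ ≤ 1 / (4 * K) * ‖a‖ + n * (‖a‖ * η) := by
    intro i
    have h1 : A a i = ∑ k, a k * D i k y - ∑ k, a k * (D i k y - D i k x₀) := by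
      rw [hAa, ← Finset.sum_sub_distrib]
      exact Finset.sum_congr rfl fun k _ => by ring
    have h2 : |∑ k, a k * (D i k y - D i k x₀)| ≤ n * (‖a‖ * η) := by
      refine (Finset.abs_sum_le_sum_abs _ _).trans ?_
      rw [hn, ← nsmul_eq_mul, ← Finset.card_univ]
      refine Finset.sum_le_card_nsmul _ _ _ fun k _ => ?_
      rw [abs_mul]
      exact mul_le_mul (norm_le_pi_norm a k) (hy i k).le (abs_nonneg _) (norm_nonneg _)
    rw [h1, Real.norm_eq_abs]
    exact (abs_sub _ _).trans (add_le_add (hcon i).le h2)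
  have h3 : ‖A a‖ ≤ 1 / (4 * K) * ‖a‖ + n * (‖a‖ * η) :=
    (pi_norm_le_iff_of_nonneg (by positivity)).2 hAi
  have h4 := hlow a
  have h5 : (K : ℝ) * (1 / (4 * K) * ‖a‖ + n * (‖a‖ * η)) < ‖a‖ := by
    have : (K : ℝ) * (1 / (4 * K) * ‖a‖ + n * (‖a‖ * η)) =
        (1 / 4 + 1 / 2 * (n / (n + 1))) * ‖a‖ := by
      rw [hη]; field_simp
    rw [this]
    have : n / (n + 1) ≤ 1 := (div_le_one (by positivity)).2 (by linarith)
    nlinarith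
  have := mul_le_mul_of_nonneg_left h3 hK'.le
  linarith

/-! ### Linear combinations, Wronskians and rescaled jets -/

/-- The linear combination of the functions `F k` with coefficients `a`. -/
noncomputable def linComb {ι : Type*} [Fintype ι] (F : ι → ℝ → ℝ) (a : ι → ℝ) (x : ℝ) : ℝ :=
  ∑ k, a k * F k x

/-- The linear combination of the derivatives of the functions `F k` with coefficients `a`. -/
noncomputable def linCombDeriv {ι : Type*} [Fintype ι] (F : ι → ℝ → ℝ) (a : ι → ℝ) (x : ℝ) : ℝ :=
  ∑ k, a k * deriv (F k) x

/-- The Wronskian of two linear combinations of the functions `F k`. -/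
noncomputable def wronskianComb {ι : Type*} [Fintype ι] (F : ι → ℝ → ℝ) (a b : ι → ℝ) (x : ℝ) :
    ℝ :=
  linComb F a x * linCombDeriv F b x - linCombDeriv F a x * linComb F b x

section linComb

variable {ι : Type*} [Fintype ι] (F : ι → ℝ → ℝ)

lemma linComb_add (a b : ι → ℝ) (x : ℝ) :
    linComb F (a + b) x = linComb F a x + linComb F b x := by
  simp [linComb, add_mul, Finset.sum_add_distrib]

lemma linComb_smul (t : ℝ) (a : ι → ℝ) (x : ℝ) : linComb F (t • a) x = t * linComb F a x := by
  simp [linComb, Finset.mul_sum, mul_assoc]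

lemma linCombDeriv_add (a b : ι → ℝ) (x : ℝ) :
    linCombDeriv F (a + b) x = linCombDeriv F a x + linCombDeriv F b x := by
  simp [linCombDeriv, add_mul, Finset.sum_add_distrib]

lemma linCombDeriv_smul (t : ℝ) (a : ι → ℝ) (x : ℝ) :
    linCombDeriv F (t • a) x = t * linCombDeriv F a x := by
  simp [linCombDeriv, Finset.mul_sum, mul_assoc]

/-- The Taylor coefficients at `y`, rescaled by `s`, of a linear combination of the functions
`F k`. -/
noncomputable def rescaledJet (d : ℕ) (y s : ℝ) : (ι → ℝ) →ₗ[ℝ] EuclideanSpace ℝ (Fin d) where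
  toFun a := WithLp.toLp 2 fun i : Fin d =>
    ∑ k, a k * (s ^ (i : ℕ) * (iteratedDeriv i (F k) y / ((i : ℕ).factorial : ℝ)))
  map_add' a b := by
    ext i; simp [add_mul, Finset.sum_add_distrib]
  map_smul' t a := by
    ext i; simp [Finset.mul_sum, mul_assoc]

lemma rescaledJet_apply (d : ℕ) (y s : ℝ) (a : ι → ℝ) (i : Fin d) :
    rescaledJet F d y s a i =
      ∑ k, a k * (s ^ (i : ℕ) * (iteratedDeriv i (F k) y / ((i : ℕ).factorial : ℝ))) := rfl

lemma polyEval_rescaledJet (L : ℕ) (y s : ℝ) (a : ι → ℝ) (t : ℝ) :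
    polyEval (rescaledJet F (L + 1) y s a) t = ∑ k, a k * ∑ i ∈ Finset.range (L + 1),
      iteratedDeriv i (F k) y / (i.factorial : ℝ) * (y + s * t - y) ^ i := by
  simp only [polyEval, rescaledJet_apply, Finset.sum_range, Finset.mul_sum, Finset.sum_mul]
  rw [Finset.sum_comm]
  refine Finset.sum_congr rfl fun k _ => Finset.sum_congr rfl fun i _ => ?_
  rw [add_sub_cancel_left, mul_pow]; ring

lemma polyDeriv_rescaledJet (L : ℕ) (y s : ℝ) (a : ι → ℝ) (t : ℝ) :
    polyDeriv (rescaledJet F (L + 2) y s a) t =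
      s * ∑ k, a k * ∑ i ∈ Finset.range (L + 1),
        iteratedDeriv (i + 1) (F k) y / (i.factorial : ℝ) * (y + s * t - y) ^ i := by
  simp only [polyDeriv, rescaledJet_apply]
  rw [Fin.sum_univ_succ]
  simp only [Fin.val_zero, Nat.cast_zero, zero_mul, mul_zero, zero_add, Fin.val_succ,
    Nat.add_sub_cancel, Finset.sum_range, Finset.mul_sum, Finset.sum_mul]
  rw [Finset.sum_comm]
  refine Finset.sum_congr rfl fun k _ => Finset.sum_congr rfl fun i _ => ?_
  rw [add_sub_cancel_left, mul_pow, Nat.factorial_succ]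
  push_cast
  field_simp
  ring

variable {F}

lemma abs_sum_mul_sub_le {u v : ι → ℝ} {η : ℝ} (a : ι → ℝ) (h : ∀ k, |u k - v k| ≤ η) :
    |∑ k, a k * u k - ∑ k, a k * v k| ≤ Fintype.card ι * (‖a‖ * η) := by
  rw [← Finset.sum_sub_distrib]
  refine (Finset.abs_sum_le_sum_abs _ _).trans ?_
  rw [← nsmul_eq_mul, ← Finset.card_univ]
  refine Finset.sum_le_card_nsmul _ _ _ fun k _ => ?_
  rw [← mul_sub, abs_mul]
  exact mul_le_mul (norm_le_pi_norm a k) (h k) (abs_nonneg _) (norm_nonneg _)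

lemma mem_ball_add_mul {y s t : ℝ} (hs : 0 < s) (ht : t ∈ ball (0 : ℝ) 1) :
    y + s * t ∈ ball y s := by
  rw [mem_ball, Real.dist_eq, sub_zero] at ht
  rw [mem_ball, Real.dist_eq, add_sub_cancel_left, abs_mul, abs_of_pos hs]
  nlinarith

/-- Linear combinations are approximated, in the `C¹` sense, by their Taylor polynomials. -/
lemma abs_linComb_sub_polyEval_le {L : ℕ} {S : Set ℝ} (hS : IsOpen S)
    (hF : ∀ k, ContDiffOn ℝ (L + 1 : ℕ) (F k) S) {y s ω : ℝ} (hs : 0 < s) (hyS : ball y s ⊆ S)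
    (hω : ∀ k, ∀ x ∈ ball y s,
      |iteratedDeriv (L + 1) (F k) x - iteratedDeriv (L + 1) (F k) y| ≤ ω)
    (a : ι → ℝ) {t : ℝ} (ht : t ∈ ball (0 : ℝ) 1) :
    |linComb F a (y + s * t) - polyEval (rescaledJet F (L + 2) y s a) t|
        ≤ Fintype.card ι * (‖a‖ * (ω * s ^ (L + 1))) ∧
    |s * linCombDeriv F a (y + s * t) - polyDeriv (rescaledJet F (L + 2) y s a) t|
        ≤ Fintype.card ι * (‖a‖ * (ω * s ^ (L + 1))) := by
  have hx := mem_ball_add_mul (y := y) hs ht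
  constructor
  · rw [polyEval_rescaledJet]
    exact abs_sum_mul_sub_le a fun k => abs_sub_taylor_le hS (hF k) hs hyS (hω k) _ hx
  · rw [polyDeriv_rescaledJet, ← mul_sub, abs_mul, abs_of_pos hs]
    have := abs_sum_mul_sub_le a fun k => abs_deriv_sub_taylor_le hS (hF k) hs hyS (hω k) _ hx
    calc _ ≤ s * (Fintype.card ι * (‖a‖ * (ω * s ^ L))) := by
          gcongr; exact this
      _ = _ := by ring

end linComb

/-! ### Spreading on every interval with uniform constants -/

/-- On the interval with centre `y` and half-length `s`, the function `g` has size at most `M κ`,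
and at least `ε κ` on half of the interval. -/
def IsSpreadOn (ε M κ : ℝ) (g : ℝ → ℝ) (y s : ℝ) : Prop :=
  (∀ x ∈ ball y s, |g x| ≤ M * κ) ∧
    volume {x ∈ ball y s | |g x| < ε * κ} ≤ ENNReal.ofReal s

lemma isSpreadOn_zero {ε M y s : ℝ} {g : ℝ → ℝ} (hg : ∀ x, g x = 0) :
    IsSpreadOn ε M 0 g y s := by
  refine ⟨fun x _ => by simp [hg], ?_⟩
  simp [hg]

/-- Transfer from a model function: where `|W| < ε`, the model satisfies `|p| < 2 * ε`, a set
already known to be small. -/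
lemma IsSpreadOn.of_approx {ε M κ y s : ℝ} {g W p : ℝ → ℝ} (hs : 0 < s) (hκ : 0 < κ)
    (hg : ∀ t ∈ ball (0 : ℝ) 1, g (y + s * t) = κ * W t)
    (hW : ∀ t ∈ ball (0 : ℝ) 1, |W t - p t| ≤ ε)
    (hM : ∀ t ∈ ball (0 : ℝ) 1, |p t| + ε ≤ M)
    (hp : volume {t ∈ ball (0 : ℝ) 1 | |p t| < 2 * ε} ≤ 1) : IsSpreadOn ε M κ g y s := by
  constructor
  · intro x hx
    have ht : (x - y) / s ∈ ball (0 : ℝ) 1 := by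
      rw [mem_ball, Real.dist_eq] at hx ⊢
      rwa [sub_zero, abs_div, abs_of_pos hs, div_lt_one hs]
    have := hg _ ht
    rw [mul_div_cancel₀ _ hs.ne', add_sub_cancel] at this
    rw [this, abs_mul, abs_of_pos hκ, mul_comm]
    refine mul_le_mul_of_nonneg_right ?_ hκ.le
    have h1 := abs_sub_abs_le_abs_sub (W ((x - y) / s)) (p ((x - y) / s))
    linarith [hW _ ht, hM _ ht]
  · rw [volume_ball_sep_eq hs (fun x => |g x| < ε * κ)]
    calc _ ≤ ENNReal.ofReal s * 1 := by
          gcongr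
          refine (measure_mono ?_).trans hp
          refine fun t ht => ⟨ht.1, ?_⟩
          have h2 := ht.2
          rw [hg t ht.1, abs_mul, abs_of_pos hκ, mul_comm, mul_lt_mul_iff_left₀ hκ] at h2
          have h1 := abs_sub_abs_le_abs_sub (p t) (W t)
          rw [abs_sub_comm] at h1
          show |p t| < 2 * ε
          linarith [hW _ ht.1]
      _ = _ := mul_one _

lemma continuousAt_iteratedDeriv_of_contDiffOn {g : ℝ → ℝ} {S : Set ℝ} {x : ℝ} {L i : ℕ}
    (hS : IsOpen S) (hx : x ∈ S) (hg : ContDiffOn ℝ L g S) (hi : i ≤ L) :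
    ContinuousAt (iteratedDeriv i g) x :=
  ((hg.continuousOn_iteratedDerivWithin (by exact_mod_cast hi) hS.uniqueDiffOn).congr
    fun _ hz => (iteratedDerivWithin_of_isOpen hS hz).symm).continuousAt (hS.mem_nhds hx)

/-- Near a point of non-degeneracy, linear combinations of the functions `F k` and their
Wronskians are spread on every interval, with uniform constants. -/
theorem exists_isSpreadOn {ι : Type*} [Fintype ι] {F : ι → ℝ → ℝ} {L : ℕ} {x₀ δ₀ : ℝ}
    (hδ₀ : 0 < δ₀) (hF : ∀ k, ContDiffOn ℝ (L + 1 : ℕ) (F k) (ball x₀ δ₀))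
    (hnd : ∀ a : ι → ℝ, (∀ i ≤ L + 1, ∑ k, a k * iteratedDeriv i (F k) x₀ = 0) → a = 0) :
    ∃ δ ε M : ℝ, 0 < δ ∧ δ ≤ δ₀ ∧ 0 < ε ∧ 0 < M ∧ ∃ R : ℝ → ℝ, (∀ s, 0 < s → 0 < R s) ∧
      ∀ y s : ℝ, 0 < s → ball y s ⊆ ball x₀ δ →
        (∀ a : ι → ℝ, ∃ κ : ℝ, 0 ≤ κ ∧ IsSpreadOn ε M κ (linComb F a) y s ∧
          ∀ i, |a i| ≤ κ * R s) ∧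
        (∀ a b : ι → ℝ, ∃ κ : ℝ, 0 ≤ κ ∧ IsSpreadOn ε M κ (wronskianComb F a b) y s ∧
          ∀ i j, |a i * b j - a j * b i| ≤ κ * R s) := by
  obtain ⟨ε₀, M₀, hε₀, hM₀, hP₁, hP₂⟩ := exists_polyEval_bounds (L + 2)
  set ε : ℝ := min (ε₀ / 2) 1 with hε
  have hε0 : 0 < ε := lt_min (half_pos hε₀) one_pos
  have hε1 : ε ≤ 1 := min_le_right _ _
  have hεε₀ : 2 * ε ≤ ε₀ := by linarith [min_le_left (ε₀ / 2) 1]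
  -- A Wronskian is a difference of two products, each perturbed by at most `(2 * M₀ + 1) * η`; the
  -- total is then `ε`.
  set η : ℝ := ε / (2 * (2 * M₀ + 1)) with hη
  have hη0 : 0 < η := by positivity
  have hηε : 2 * (2 * M₀ + 1) * η = ε := by rw [hη]; field_simp
  have hηε' : η ≤ ε := by nlinarith
  have hη1 : η ≤ 1 := hηε'.trans hε1
  set n : ℝ := (Fintype.card ι : ℝ) with hn
  have hn0 : 0 ≤ n := Nat.cast_nonneg _
  have hx₀ : x₀ ∈ ball x₀ δ₀ := mem_ball_self hδ₀
  have hcont : ∀ i ≤ L + 1, ∀ k, ContinuousAt (iteratedDeriv i (F k)) x₀ := fun i hi k =>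
    continuousAt_iteratedDeriv_of_contDiffOn isOpen_ball hx₀ (hF k) hi
  obtain ⟨c, hc, hlow⟩ := eventually_exists_le_abs_sum (d := L + 1) (x₀ := x₀)
    (D := fun i k y => iteratedDeriv i (F k) y / ((i : ℕ).factorial : ℝ))
    (fun i k => (hcont i (by omega) k).div_const _)
    (fun a ha => hnd a fun i hi => by
      have := ha ⟨i, by omega⟩
      simp only [← mul_div_assoc, ← Finset.sum_div] at this
      exact (div_eq_zero_iff.1 this).resolve_right (by positivity))
  set ω : ℝ := η * c / (n + 1) with hω
  have hω0 : 0 < ω := by positivity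
  have hosc : ∀ᶠ x in 𝓝 x₀, ∀ k,
      |iteratedDeriv (L + 1) (F k) x - iteratedDeriv (L + 1) (F k) x₀| < ω / 2 := by
    refine eventually_all.2 fun k => ?_
    have := (hcont (L + 1) le_rfl k).eventually (ball_mem_nhds _ (half_pos hω0))
    simpa [Real.dist_eq] using this
  obtain ⟨δ₁, hδ₁, hev⟩ := Metric.eventually_nhds_iff_ball.1 (hosc.and hlow)
  set δ : ℝ := min (min δ₁ δ₀) 1 with hδ
  have hδδ₁ : δ ≤ δ₁ := (min_le_left _ _).trans (min_le_left _ _)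
  have hδδ₀ : δ ≤ δ₀ := (min_le_left _ _).trans (min_le_right _ _)
  have hδ1 : δ ≤ 1 := min_le_right _ _
  -- `r s` bounds the coefficients of a combination whose rescaled jet has norm one. In the witness
  -- for `R` below, the summand `r s` serves linear combinations and `s * (2 * r s ^ 2)` serves
  -- Wronskians.
  set r : ℝ → ℝ := fun s => 1 / (c * s ^ (L + 1)) with hr
  have hr0 : ∀ s, 0 < s → 0 < r s := fun s hs => by positivity
  refine ⟨δ, ε, 2 * M₀ ^ 2 + M₀ + 1, lt_min (lt_min hδ₁ hδ₀) one_pos, hδδ₀, hε0, by positivity,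
    fun s => r s + s * (2 * r s ^ 2), fun s hs => by have := hr0 s hs; positivity, ?_⟩
  intro y s hs hys
  have hrs := hr0 s hs
  have hs1 : s ≤ 1 := by
    have h := measure_mono (μ := volume) hys
    rw [Real.volume_ball, Real.volume_ball,
      ENNReal.ofReal_le_ofReal_iff (by have := lt_min (lt_min hδ₁ hδ₀) one_pos; positivity)] at h
    linarith
  have hy₁ : y ∈ ball x₀ δ₁ := ball_subset_ball hδδ₁ (hys (mem_ball_self hs))
  have hosc' : ∀ k, ∀ x ∈ ball y s,
      |iteratedDeriv (L + 1) (F k) x - iteratedDeriv (L + 1) (F k) y| ≤ ω := by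
    intro k x hx
    have h1 := (hev x (ball_subset_ball hδδ₁ (hys hx))).1 k
    have h2 := (hev y hy₁).1 k
    rw [abs_lt] at h1 h2
    rw [abs_le]; constructor <;> linarith
  set T := rescaledJet F (L + 2) y s with hT
  have hTlow : ∀ a, ‖a‖ ≤ ‖T a‖ * r s := by
    intro a
    obtain ⟨i, hi⟩ := (hev y hy₁).2 a
    have h1 : |T a i| ≤ ‖T a‖ := PiLp.norm_apply_le (T a) i
    have h2 : T a i = s ^ (i : ℕ) *
        ∑ k, a k * (iteratedDeriv i (F k) y / ((i : ℕ).factorial : ℝ)) := by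
      rw [hT, rescaledJet_apply, Finset.mul_sum]
      exact Finset.sum_congr rfl fun k _ => by ring
    have h3 : s ^ (L + 1) ≤ s ^ (i : ℕ) := pow_le_pow_of_le_one hs.le hs1 (by omega)
    rw [h2, abs_mul, abs_of_pos (pow_pos hs _)] at h1
    have h4 : s ^ (L + 1) * (c * ‖a‖) ≤ ‖T a‖ :=
      (mul_le_mul h3 hi (by positivity) (by positivity)).trans h1
    rw [hr, mul_one_div, le_div_iff₀ (by positivity)]
    linarith
  have hT0 : ∀ a, a ≠ 0 → 0 < ‖T a‖ := by
    intro a ha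
    have := hTlow a
    have h2 : 0 < ‖a‖ := norm_pos_iff.2 ha
    by_contra h
    have h3 : ‖T a‖ = 0 := le_antisymm (not_lt.1 h) (norm_nonneg _)
    rw [h3, zero_mul] at this
    linarith
  have hnorm : ∀ a, a ≠ 0 → ∃ (p : ℝ) (a' : ι → ℝ), 0 < p ∧ a = p • a' ∧ ‖T a'‖ = 1 := by
    intro a ha
    have hp := hT0 a ha
    refine ⟨‖T a‖, ‖T a‖⁻¹ • a, hp, (smul_inv_smul₀ hp.ne' a).symm, ?_⟩
    rw [map_smul, norm_smul, norm_inv, norm_norm, inv_mul_cancel₀ hp.ne']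
  -- Scale invariance: the Taylor error contains `‖a‖ * s ^ (L + 1)`, and the normalisation `‖T a‖ =
  -- 1` bounds this by `1 / c` because of `hTlow`. The choice of `ω` absorbs `c` and the number of
  -- functions.
  have happ : ∀ a, ‖T a‖ = 1 → ∀ t ∈ ball (0 : ℝ) 1,
      |linComb F a (y + s * t) - polyEval (T a) t| ≤ η ∧
      |s * linCombDeriv F a (y + s * t) - polyDeriv (T a) t| ≤ η := by
    intro a ha t ht
    have h1 := abs_linComb_sub_polyEval_le isOpen_ball hF hs
      (hys.trans (ball_subset_ball hδδ₀)) hosc' a ht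
    have h2 : n * (‖a‖ * (ω * s ^ (L + 1))) ≤ η := by
      have h3 := hTlow a
      rw [ha, one_mul, hr, le_div_iff₀ (by positivity)] at h3
      calc n * (‖a‖ * (ω * s ^ (L + 1))) = (n / (n + 1)) * (η * (‖a‖ * (c * s ^ (L + 1)))) := by
            rw [hω]; field_simp
        _ ≤ 1 * (η * 1) := by
            gcongr
            exact (div_le_one (by positivity)).2 (by linarith)
        _ = η := by ring
    exact ⟨h1.1.trans h2, h1.2.trans h2⟩
  constructor
  · intro a
    by_cases ha : a = 0
    · subst ha
      exact ⟨0, le_rfl, isSpreadOn_zero fun x => by simp [linComb], by simp⟩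
    obtain ⟨p, a', hp, rfl, hTa'⟩ := hnorm a ha
    refine ⟨p, hp.le, ?_, fun i => ?_⟩
    · refine IsSpreadOn.of_approx (W := fun t => linComb F a' (y + s * t))
        (p := polyEval (T a')) hs hp (fun t _ => ?_)
        (fun t ht => (happ a' hTa' t ht).1.trans hηε') (fun t ht => ?_) ?_
      · rw [linComb_smul]
      · have := ((hP₁ _ hTa').1 t ht).1
        nlinarith [sq_nonneg M₀]
      · refine (measure_mono ?_).trans (hP₁ _ hTa').2
        exact fun x hx => ⟨hx.1, hx.2.trans_le hεε₀⟩
    · calc |(p • a') i| ≤ ‖p • a'‖ := norm_le_pi_norm (p • a') i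
        _ ≤ p * r s := by
          have h : ‖T (p • a')‖ = p := by
            rw [map_smul, norm_smul, hTa', mul_one, Real.norm_of_nonneg hp.le]
          simpa only [h] using hTlow (p • a')
        _ ≤ _ := by
          gcongr
          have : 0 < s * (2 * r s ^ 2) := by positivity
          linarith
  · intro a b
    by_cases ha : a = 0
    · subst ha
      exact ⟨0, le_rfl, isSpreadOn_zero fun x => by simp [wronskianComb, linComb, linCombDeriv],
        by simp⟩
    obtain ⟨p, a', hp, rfl, hTa'⟩ := hnorm a ha
    -- Gram–Schmidt: subtracting a multiple of `a'` from `b` changes neither the Wronskian nor the 2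
    -- × 2 minors of the coefficients.
    obtain ⟨u, w, rfl, horthw⟩ : ∃ (u : ℝ) (w : ι → ℝ), b = u • a' + w ∧
        inner ℝ (T a') (T w) = 0 := by
      refine ⟨inner ℝ (T a') (T b), b - inner ℝ (T a') (T b) • a', by abel, ?_⟩
      rw [map_sub, map_smul, inner_sub_right, inner_smul_right, real_inner_self_eq_norm_sq, hTa']
      ring
    by_cases hw0 : w = 0
    · subst hw0
      refine ⟨0, le_rfl, isSpreadOn_zero fun x => ?_, fun i j => ?_⟩
      · simp only [wronskianComb, add_zero, linComb_smul, linCombDeriv_smul]; ring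
      · simp only [add_zero, Pi.smul_apply, smul_eq_mul, zero_mul]
        rw [abs_nonpos_iff]; ring
    obtain ⟨q, b', hq, rfl, hTb'⟩ := hnorm w hw0
    have horth : inner ℝ (T a') (T b') = 0 := by
      rw [map_smul, inner_smul_right] at horthw
      exact (mul_eq_zero.1 horthw).resolve_left hq.ne'
    -- Differentiation in the rescaled variable multiplies by `s`, hence the division by `s`.
    refine ⟨p * q / s, by positivity, ?_, fun i j => ?_⟩
    · refine IsSpreadOn.of_approx
        (W := fun t => linComb F a' (y + s * t) * (s * linCombDeriv F b' (y + s * t)) -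
          (s * linCombDeriv F a' (y + s * t)) * linComb F b' (y + s * t))
        (p := fun t => polyEval (T a') t * polyDeriv (T b') t -
          polyDeriv (T a') t * polyEval (T b') t) hs (by positivity) (fun t _ => ?_)
        (fun t ht => ?_) (fun t ht => ?_) ?_
      · simp only [wronskianComb, linComb_smul, linCombDeriv_smul, linComb_add, linCombDeriv_add]
        field_simp
        ring
      · obtain ⟨h1, h2⟩ := happ a' hTa' t ht
        obtain ⟨h3, h4⟩ := happ b' hTb' t ht
        obtain ⟨h5, h6⟩ := (hP₁ _ hTa').1 t ht
        obtain ⟨h7, h8⟩ := (hP₁ _ hTb').1 t ht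
        have aux : ∀ {A B P Q : ℝ}, |A - P| ≤ η → |B - Q| ≤ η → |P| ≤ M₀ → |Q| ≤ M₀ →
            |A * B - P * Q| ≤ (2 * M₀ + 1) * η := by
          intro A B P Q hA hB hP hQ
          have : A * B - P * Q = (A - P) * (B - Q) + (A - P) * Q + P * (B - Q) := by ring
          rw [this]
          calc _ ≤ |(A - P) * (B - Q)| + |(A - P) * Q| + |P * (B - Q)| := abs_add_three _ _ _
            _ ≤ η * 1 + η * M₀ + M₀ * η := by
              rw [abs_mul, abs_mul, abs_mul]
              gcongr
              exact hB.trans hη1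
            _ = _ := by ring
        have e1 := aux h1 h4 h5 h8
        have e2 := aux h2 h3 h6 h7
        rw [abs_le] at e1 e2 ⊢
        constructor <;> linarith [e1.1, e1.2, e2.1, e2.2]
      · obtain ⟨h5, h6⟩ := (hP₁ _ hTa').1 t ht
        obtain ⟨h7, h8⟩ := (hP₁ _ hTb').1 t ht
        have : |polyEval (T a') t * polyDeriv (T b') t -
            polyDeriv (T a') t * polyEval (T b') t| ≤ M₀ * M₀ + M₀ * M₀ := by
          refine (abs_sub _ _).trans ?_
          rw [abs_mul, abs_mul]
          gcongr
        nlinarith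
      · refine (measure_mono ?_).trans (hP₂ _ _ hTa' hTb' horth)
        exact fun x hx => ⟨hx.1, hx.2.trans_le hεε₀⟩
    · have h1 : ∀ k, |a' k| ≤ r s := fun k => by
        have := hTlow a'
        rw [hTa', one_mul] at this
        exact (norm_le_pi_norm a' k).trans this
      have h2 : ∀ k, |b' k| ≤ r s := fun k => by
        have := hTlow b'
        rw [hTb', one_mul] at this
        exact (norm_le_pi_norm b' k).trans this
      have h3 : (p • a') i * (u • a' + q • b') j - (p • a') j * (u • a' + q • b') i =
          p * q * (a' i * b' j - a' j * b' i) := by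
        simp only [Pi.smul_apply, Pi.add_apply, smul_eq_mul]
        ring
      rw [h3, abs_mul, abs_of_pos (mul_pos hp hq)]
      calc _ ≤ p * q * (r s * r s + r s * r s) := by
            gcongr
            refine (abs_sub _ _).trans ?_
            rw [abs_mul, abs_mul]
            gcongr <;> first | exact h1 _ | exact h2 _
        _ = p * q / s * (s * (2 * r s ^ 2)) := by field_simp; ring
        _ ≤ _ := by
          gcongr
          linarith

lemma IsSpreadOn.congr_abs {ε M κ y s : ℝ} {g h : ℝ → ℝ} (hg : IsSpreadOn ε M κ g y s)
    (hgh : ∀ x, |h x| = |g x|) : IsSpreadOn ε M κ h y s := by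
  simpa only [IsSpreadOn, hgh] using hg

/-- The supremum is at most `M * κ`, so a level `ε₁ * sup` lies below `ε * κ`. The scale `κ` drops
out, leaving a condition on the uniform constants only. -/
lemma IsSpreadOn.volume_le {ε M κ ε₁ y s : ℝ} {g : ℝ → ℝ} (hg : IsSpreadOn ε M κ g y s)
    (hκ : 0 ≤ κ) (hε₁ : 0 ≤ ε₁) (h : ε₁ * M ≤ ε) :
    volume {x ∈ ball y s | ‖g x‖ₑ < ENNReal.ofReal ε₁ * supAbs g (ball y s)}
      ≤ ENNReal.ofReal s := by
  refine (measure_mono ?_).trans hg.2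
  refine fun x hx => ⟨hx.1, ?_⟩
  have h1 : supAbs g (ball y s) ≤ ENNReal.ofReal (M * κ) := by
    refine iSup₂_le fun z hz => ?_
    rw [Real.enorm_eq_ofReal_abs]
    exact ENNReal.ofReal_le_ofReal (hg.1 z hz)
  have h2 : ‖g x‖ₑ < ENNReal.ofReal (ε₁ * (M * κ)) := by
    rw [ENNReal.ofReal_mul hε₁]
    exact hx.2.trans_le (by gcongr)
  rw [Real.enorm_eq_ofReal_abs] at h2
  have h3 := (ENNReal.ofReal_lt_ofReal_iff_of_nonneg (abs_nonneg _)).1 h2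
  show |g x| < ε * κ
  nlinarith

/-- Otherwise the sublevel set would be the whole interval, of measure `2 * s > s`. -/
lemma IsSpreadOn.le_supAbs {ε M κ y s : ℝ} {g : ℝ → ℝ} (hg : IsSpreadOn ε M κ g y s)
    (hs : 0 < s) : ENNReal.ofReal (ε * κ) ≤ supAbs g (ball y s) := by
  by_contra! hlt
  have h1 : {x ∈ ball y s | |g x| < ε * κ} = ball y s := by
    refine Set.Subset.antisymm (fun x hx => hx.1) fun x hx => ⟨hx, ?_⟩
    have h2 := (enorm_le_supAbs (g := g) hx).trans_lt hlt
    rw [Real.enorm_eq_ofReal_abs] at h2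
    exact (ENNReal.ofReal_lt_ofReal_iff_of_nonneg (abs_nonneg _)).1 h2
  have h2 := hg.2
  rw [h1, Real.volume_ball, ENNReal.ofReal_le_ofReal_iff hs.le] at h2
  linarith

/-! ### The lifted curve and its non-degeneracy -/

/-- The curve `x ↦ (1, x, f₁(x), …, f_m(x))`, by components. -/
def liftedCurve {m : ℕ} (f : Fin m → ℝ → ℝ) : Fin (m + 2) → ℝ → ℝ :=
  Matrix.vecCons (fun _ => 1) (Matrix.vecCons (fun x => x) f)

lemma liftedCurve_succ {m : ℕ} (f : Fin m → ℝ → ℝ) (k : Fin (m + 1)) (x : ℝ) :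
    liftedCurve f k.succ x = mongeCurve f x k := by
  refine Fin.cases ?_ (fun i => ?_) k <;> simp [liftedCurve, mongeCurve]

lemma contDiffOn_liftedCurve {m L : ℕ} {f : Fin m → ℝ → ℝ} {S : Set ℝ}
    (hf : ContDiffOn ℝ L (mongeCurve f) S) (k : Fin (m + 2)) :
    ContDiffOn ℝ L (liftedCurve f k) S := by
  refine Fin.cases ?_ (fun i => ?_) k
  · exact contDiffOn_const
  · exact (contDiffOn_pi.1 hf i).congr fun x _ => liftedCurve_succ f i x

lemma iteratedDeriv_pi_apply {n L i : ℕ} {g : ℝ → Fin n → ℝ} {x : ℝ}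
    (hg : ContDiffAt ℝ L g x) (hi : i ≤ L) (k : Fin n) :
    iteratedDeriv i g x k = iteratedDeriv i (fun x => g x k) x := by
  have := (ContinuousLinearMap.proj (R := ℝ) (φ := fun _ : Fin n => ℝ) k).iteratedFDeriv_comp_left
    hg (i := i) (by exact_mod_cast hi)
  have h2 := congrArg (fun T => T fun _ => (1 : ℝ)) this
  exact h2.symm

/-- Positive-order derivatives do not see the constant component, so the spanning hypothesis kills
all other coefficients; order zero then kills the constant one. -/
lemma eq_zero_of_sum_mul_iteratedDeriv_eq_zero {m L : ℕ} {f : Fin m → ℝ → ℝ} {x₀ δ₀ : ℝ}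
    (hδ₀ : 0 < δ₀) (hf : ContDiffOn ℝ L (mongeCurve f) (ball x₀ δ₀))
    (hspan : Submodule.span ℝ {v | ∃ i : ℕ, 1 ≤ i ∧ i ≤ L ∧
      v = iteratedDeriv i (mongeCurve f) x₀} = ⊤)
    (a : Fin (m + 2) → ℝ)
    (ha : ∀ i ≤ L, ∑ k, a k * iteratedDeriv i (liftedCurve f k) x₀ = 0) : a = 0 := by
  have hfa : ContDiffAt ℝ L (mongeCurve f) x₀ := hf.contDiffAt (ball_mem_nhds _ hδ₀)
  let A : (Fin (m + 1) → ℝ) →ₗ[ℝ] ℝ := dotProductBilin ℝ ℝ (fun k => a k.succ)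
  have hA : A = 0 := by
    refine LinearMap.ext_on hspan ?_
    rintro _ ⟨i, hi1, hi2, rfl⟩
    have h := ha i hi2
    rw [Fin.sum_univ_succ] at h
    have h0 : iteratedDeriv i (liftedCurve f 0) x₀ = 0 := by
      show iteratedDeriv i (fun _ => (1 : ℝ)) x₀ = 0
      rw [iteratedDeriv_const]; simp; omega
    rw [h0, mul_zero, zero_add] at h
    show ∑ k : Fin (m + 1), a k.succ * iteratedDeriv i (mongeCurve f) x₀ k = 0
    rw [← h]
    refine Finset.sum_congr rfl fun k _ => ?_
    rw [iteratedDeriv_pi_apply hfa hi2]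
    congr 2
    exact funext fun x => (liftedCurve_succ f k x).symm
  have hsucc : ∀ k : Fin (m + 1), a k.succ = 0 := by
    intro k
    have h : ∑ j : Fin (m + 1), a j.succ * (Pi.single k 1 : Fin (m + 1) → ℝ) j = 0 :=
      LinearMap.congr_fun hA (Pi.single k 1)
    simpa [Pi.single_apply] using h
  have hzero := ha 0 (Nat.zero_le _)
  rw [Fin.sum_univ_succ] at hzero
  simp only [hsucc, zero_mul, Finset.sum_const_zero, add_zero, iteratedDeriv_zero] at hzero
  have h0 : a 0 = 0 := by simpa [liftedCurve] using hzero
  ext k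
  exact Fin.cases h0 hsucc k

lemma continuousOn_linComb {ι : Type*} [Fintype ι] {F : ι → ℝ → ℝ} {S V : Set ℝ} {L : ℕ}
    (hVS : V ⊆ S) (hF : ∀ k, ContDiffOn ℝ (L + 1 : ℕ) (F k) S) (a : ι → ℝ) :
    ContinuousOn (linComb F a) V :=
  continuousOn_finsetSum _ fun k _ => continuousOn_const.mul ((hF k).continuousOn.mono hVS)

lemma continuousOn_wronskianComb {ι : Type*} [Fintype ι] {F : ι → ℝ → ℝ} {S V : Set ℝ} {L : ℕ}
    (hS : IsOpen S) (hVS : V ⊆ S) (hF : ∀ k, ContDiffOn ℝ (L + 1 : ℕ) (F k) S) (a b : ι → ℝ) :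
    ContinuousOn (wronskianComb F a b) V := by
  have hd : ∀ a : ι → ℝ, ContinuousOn (linCombDeriv F a) V := fun a =>
    continuousOn_finsetSum _ fun k _ => continuousOn_const.mul
      (((hF k).continuousOn_deriv_of_isOpen hS (by simp)).mono hVS)
  exact ((continuousOn_linComb hVS hF a).mul (hd b)).sub
    ((hd a).mul (continuousOn_linComb hVS hF b))

/-! ### Bordered determinants as decomposable alternating forms -/

open Matrix in
/-- The determinant of the square matrix with columns `y`, `z` and those of `K`. -/
noncomputable def borderedDet {r : ℕ} (K : Matrix (Fin 2 ⊕ Fin r) (Fin r) ℝ)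
    (y z : Fin 2 ⊕ Fin r → ℝ) : ℝ :=
  (fromCols (of ![y, z])ᵀ K).det

open Matrix in
/-- The bordered determinant is a decomposable alternating form. -/
lemma exists_borderedDet_eq {r : ℕ} (K : Matrix (Fin 2 ⊕ Fin r) (Fin r) ℝ) :
    ∃ α β : Fin 2 ⊕ Fin r → ℝ, ∀ y z,
      borderedDet K y z = (α ⬝ᵥ y) * (β ⬝ᵥ z) - (α ⬝ᵥ z) * (β ⬝ᵥ y) := by
  by_cases h : ∀ y z, borderedDet K y z = 0
  · exact ⟨0, 0, fun y z => by simp [h]⟩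
  push Not at h
  obtain ⟨y₀, z₀, h0⟩ := h
  set N := fromCols (of ![y₀, z₀])ᵀ K with hN
  have hNu : IsUnit N.det := isUnit_iff_ne_zero.2 h0
  -- Multiplication by `N⁻¹` turns `K` into the last columns of the identity, so the determinant
  -- reduces to a 2 × 2 block in the first two rows of `N⁻¹`. These rows are the two linear forms,
  -- the first carrying the factor `det N`.
  have hK : ∀ i j, (N⁻¹ * K) i j = (1 : Matrix (Fin 2 ⊕ Fin r) (Fin 2 ⊕ Fin r) ℝ) i (Sum.inr j) := by
    intro i j
    rw [← nonsing_inv_mul N hNu, hN, mul_fromCols, fromCols_apply_inr]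
  refine ⟨N.det • N⁻¹ (Sum.inl 0), N⁻¹ (Sum.inl 1), fun y z => ?_⟩
  have h1 : fromCols (of ![y, z])ᵀ K = N * (N⁻¹ * fromCols (of ![y, z])ᵀ K) := by
    rw [← Matrix.mul_assoc, mul_nonsing_inv N hNu, Matrix.one_mul]
  have h2 : N⁻¹ * fromCols (of ![y, z])ᵀ K =
      fromBlocks (of fun i j => (N⁻¹ * (of ![y, z])ᵀ) (Sum.inl i) j) 0
        (of fun i j => (N⁻¹ * (of ![y, z])ᵀ) (Sum.inr i) j) 1 := by
    rw [mul_fromCols]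
    ext i j
    rcases i with i | i <;> rcases j with j | j <;> simp [hK, Matrix.one_apply]
  rw [borderedDet, h1, det_mul, h2, det_fromBlocks_zero₁₂, det_one, mul_one, det_fin_two]
  simp only [of_apply, Matrix.mul_apply', smul_dotProduct, smul_eq_mul]
  have e0 : (fun i => (of ![y, z])ᵀ i 0) = y := rfl
  have e1 : (fun i => (of ![y, z])ᵀ i 1) = z := rfl
  rw [e0, e1]
  ring

open Matrix in
lemma borderedDet_eq_zero_of_row {r : ℕ} {K : Matrix (Fin 2 ⊕ Fin r) (Fin r) ℝ}
    {y z : Fin 2 ⊕ Fin r → ℝ} (p : Fin 2 ⊕ Fin r) (hK : ∀ j, K p j = 0) (hy : y p = 0)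
    (hz : z p = 0) : borderedDet K y z = 0 := by
  refine det_eq_zero_of_row_eq_zero p fun j => ?_
  rcases j with j | j
  · fin_cases j
    · exact hy
    · exact hz
  · exact hK j

open Matrix in
-- Independent columns can be completed by two more to a basis of the `(r + 2)`-dimensional space.
lemma exists_borderedDet_ne_zero {r : ℕ} {K : Matrix (Fin 2 ⊕ Fin r) (Fin r) ℝ}
    (hK : ∀ v, K *ᵥ v = 0 → v = 0) : ∃ y z, borderedDet K y z ≠ 0 := by
  have hli : LinearIndependent ℝ (fun j i => K i j) := by
    refine mulVec_injective_iff.1 fun v w hvw => ?_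
    have := hK (v - w) (by rw [mulVec_sub]; exact sub_eq_zero.2 hvw)
    exact sub_eq_zero.1 this
  obtain ⟨z, hz⟩ := exists_linearIndependent_cons_of_lt_finrank hli (by simp)
  obtain ⟨y, hy⟩ := exists_linearIndependent_cons_of_lt_finrank hz (by simp; omega)
  refine ⟨y, z, ?_⟩
  let e : Fin 2 ⊕ Fin r → Fin (r + 2) := Sum.elim ![0, 1] fun k => k.succ.succ
  have he : Function.Injective e := by
    rintro (i | i) (j | j) h
    · fin_cases i <;> fin_cases j <;> simp_all [e]
    · fin_cases i <;> simp [e, Fin.ext_iff] at h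
    · fin_cases j <;> simp [e, Fin.ext_iff] at h
    · simpa [e] using h
  have hcols : LinearIndependent ℝ (fromCols (of ![y, z])ᵀ K).col := by
    have hfun : (fromCols (of ![y, z])ᵀ K).col =
        (Fin.cons y (Fin.cons z fun j i => K i j) : Fin (r + 2) → _) ∘ e := by
      ext j i
      rcases j with j | j
      · fin_cases j <;> rfl
      · rfl
    rw [hfun]
    exact hy.comp e he
  have := linearIndependent_cols_iff_isUnit.1 hcols
  exact ((isUnit_iff_isUnit_det _).1 this).ne_zero

open Matrix in
/-- For integral `K` with independent columns, some coordinate of the bordered determinant has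
absolute value at least one. -/
lemma exists_one_le_abs_coord {r : ℕ} {K : Matrix (Fin 2 ⊕ Fin r) (Fin r) ℤ}
    (hK : ∀ v, K.map (Int.cast : ℤ → ℝ) *ᵥ v = 0 → v = 0) {α β : Fin 2 ⊕ Fin r → ℝ}
    (hαβ : ∀ y z, borderedDet (K.map (Int.cast : ℤ → ℝ)) y z =
      (α ⬝ᵥ y) * (β ⬝ᵥ z) - (α ⬝ᵥ z) * (β ⬝ᵥ y)) :
    ∃ p q, 1 ≤ |α p * β q - α q * β p| := by
  by_contra! hcon
  have hzero : ∀ p q, α p * β q - α q * β p = 0 := by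
    intro p q
    have h1 : borderedDet (K.map (Int.cast : ℤ → ℝ)) (Pi.single p 1) (Pi.single q 1) =
        α p * β q - α q * β p := by rw [hαβ]; simp
    -- On unit vectors the form is an integer determinant, so an absolute value below one means
    -- zero. If all coordinates vanished, so would the form.
    have h2 : borderedDet (K.map (Int.cast : ℤ → ℝ)) (Pi.single p 1) (Pi.single q 1) =
        ((fromCols (of ![Pi.single p 1, Pi.single q 1])ᵀ K).det : ℤ) := by
      rw [borderedDet, Int.cast_det]
      congr 1
      ext i j
      rcases j with j | j
      · fin_cases j <;> simp [Pi.single_apply, apply_ite]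
      · simp
    have h3 := hcon p q
    rw [← h1, h2, ← Int.cast_abs] at h3
    rw [← h1, h2]
    have h4 : |(fromCols (of ![Pi.single p 1, Pi.single q 1])ᵀ K).det| < 1 := by
      exact_mod_cast h3
    exact_mod_cast Int.abs_lt_one_iff.1 h4
  obtain ⟨y, z, hyz⟩ := exists_borderedDet_ne_zero hK
  refine hyz ?_
  rw [hαβ]
  have : (α ⬝ᵥ y) * (β ⬝ᵥ z) - (α ⬝ᵥ z) * (β ⬝ᵥ y) =
      ∑ p, ∑ q, (α p * β q - α q * β p) * (y p * z q) := by
    rw [mul_comm (α ⬝ᵥ z)]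
    simp only [dotProduct, Finset.sum_mul_sum]
    rw [← Finset.sum_sub_distrib]
    refine Finset.sum_congr rfl fun p _ => ?_
    rw [← Finset.sum_sub_distrib]
    exact Finset.sum_congr rfl fun q _ => by ring
  rw [this]
  simp [hzero]

/-! ### Minors as linear combinations and Wronskians -/

open Matrix in
/-- The rows of the identity matrix with indices `0`, `1` and `i + 2` for `i` in the range of `I`;
indices `i ≥ m` contribute zero rows. -/
def selectionMatrix (R : Type*) [Ring R] {m r : ℕ} (I : Fin r → Fin (m + 2)) :
    Matrix (Fin 2 ⊕ Fin r) (Fin (m + 2)) R :=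
  of (Sum.elim ![Pi.single 0 1, Pi.single 1 1]
    fun k => Fin.append (fun i : Fin m => Pi.single i.succ.succ 1) (fun _ : Fin 2 => 0) (I k))

open Matrix in
lemma selectionMatrix_map {m r : ℕ} (I : Fin r → Fin (m + 2)) :
    (selectionMatrix ℤ I).map (Int.cast : ℤ → ℝ) = selectionMatrix ℝ I := by
  ext p j
  rcases p with p | k
  · fin_cases p <;> simp [selectionMatrix, Pi.single_apply, apply_ite]
  · simp only [selectionMatrix, map_apply, of_apply, Sum.elim_inr]
    refine Fin.addCases (fun i => ?_) (fun i => ?_) (I k)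
    · simp [Pi.single_apply, apply_ite]
    · simp

open Matrix in
lemma selectionMatrix_mulVec_inl {R : Type*} [Ring R] {m r : ℕ} (I : Fin r → Fin (m + 2))
    (w : Fin (m + 2) → R) :
    (selectionMatrix R I *ᵥ w) (Sum.inl 0) = w 0 ∧ (selectionMatrix R I *ᵥ w) (Sum.inl 1) = w 1 := by
  constructor <;> simp [selectionMatrix, mulVec]

open Matrix in
lemma selectionMatrix_mulVec_castAdd {R : Type*} [Ring R] {m r : ℕ} {I : Fin r → Fin (m + 2)}
    {k : Fin r} {i : Fin m} (h : I k = Fin.castAdd 2 i) (w : Fin (m + 2) → R) :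
    (selectionMatrix R I *ᵥ w) (Sum.inr k) = w i.succ.succ := by
  simp [selectionMatrix, mulVec, h]

open Matrix in
lemma selectionMatrix_mulVec_natAdd {R : Type*} [Ring R] {m r : ℕ} {I : Fin r → Fin (m + 2)}
    {k : Fin r} {i : Fin 2} (h : I k = Fin.natAdd m i) (w : Fin (m + 2) → R) :
    (selectionMatrix R I *ᵥ w) (Sum.inr k) = 0 := by
  simp [selectionMatrix, mulVec, h]

open Matrix in
lemma selectionMatrix_mul_natAdd {R : Type*} [Ring R] {m r : ℕ} {I : Fin r → Fin (m + 2)}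
    {k : Fin r} {i : Fin 2} (h : I k = Fin.natAdd m i) (Γ : Matrix (Fin (m + 2)) (Fin r) R)
    (j : Fin r) : (selectionMatrix R I * Γ) (Sum.inr k) j = 0 := by
  rw [Matrix.mul_apply]
  exact selectionMatrix_mulVec_natAdd h fun i => Γ i j

open Matrix in
/-- Each coordinate of `α` that belongs to a nonzero row of the selection matrix is a coordinate
of its image. -/
lemma exists_vecMul_selectionMatrix_eq {m r : ℕ} {I : Fin r → Fin (m + 2)}
    (hI : Function.Injective I) {p : Fin 2 ⊕ Fin r} (hp : ∀ k, p = Sum.inr k → (I k : ℕ) < m) :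
    ∃ j, ∀ α : Fin 2 ⊕ Fin r → ℝ, (α ᵥ* selectionMatrix ℝ I) j = α p := by
  have hrow : ∀ (j : Fin (m + 2)) (α : Fin 2 ⊕ Fin r → ℝ), (α ᵥ* selectionMatrix ℝ I) j =
      α (Sum.inl 0) * (Pi.single 0 1 : Fin (m + 2) → ℝ) j +
      α (Sum.inl 1) * (Pi.single 1 1 : Fin (m + 2) → ℝ) j +
      ∑ k, α (Sum.inr k) * (Fin.append (fun i : Fin m => Pi.single i.succ.succ 1)
        (fun _ : Fin 2 => 0) (I k) : Fin (m + 2) → ℝ) j := by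
    intro j α
    simp only [vecMul, dotProduct, Fintype.sum_sum_type, Fin.sum_univ_two, selectionMatrix,
      of_apply, Sum.elim_inl, Sum.elim_inr, cons_val_zero, cons_val_one]
  have hsmall : ∀ j : Fin (m + 2), (∀ i : Fin m, i.succ.succ ≠ j) → ∀ k,
      (Fin.append (fun i : Fin m => Pi.single i.succ.succ 1)
        (fun _ : Fin 2 => 0) (I k) : Fin (m + 2) → ℝ) j = 0 := by
    intro j hj k
    refine Fin.addCases (fun i => ?_) (fun i => ?_) (I k)
    · simp [(hj i).symm]
    · simp
  rcases p with p | k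
  · fin_cases p
    · refine ⟨0, fun α => ?_⟩
      rw [hrow]
      simp only [hsmall 0 fun i => Fin.succ_ne_zero _]
      simp
    · refine ⟨1, fun α => ?_⟩
      rw [hrow]
      simp only [hsmall 1 fun i => by simp [Fin.ext_iff]]
      simp
  · have hk := hp k rfl
    obtain ⟨i, hi⟩ : ∃ i : Fin m, I k = Fin.castAdd 2 i := ⟨⟨I k, hk⟩, by ext; simp⟩
    refine ⟨i.succ.succ, fun α => ?_⟩
    rw [hrow, Finset.sum_eq_single k]
    · simp [hi, Fin.ext_iff]
    · intro k' _ hk'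
      have hne : I k' ≠ Fin.castAdd 2 i := fun h => hk' (hI (h.trans hi.symm))
      revert hne
      refine Fin.addCases (fun i' => ?_) (fun i' => ?_) (I k')
      · intro hne
        have : i' ≠ i := fun h => hne (by rw [h])
        simp [this.symm]
      · simp
    · simp

/-- The indicator of the rows `k` with `I k = m + i`. -/
def tailIndicator {m r : ℕ} (I : Fin r → Fin (m + 2)) (i : Fin 2) : Fin 2 ⊕ Fin r → ℝ :=
  Sum.elim 0 fun k => if I k = Fin.natAdd m i then 1 else 0

/-- The vector of derivatives of `liftedCurve f`. -/
noncomputable def liftedCurveDeriv {m : ℕ} (f : Fin m → ℝ → ℝ) (x : ℝ) : Fin (m + 2) → ℝ :=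
  fun k => deriv (liftedCurve f k) x

open Matrix in
lemma liftedCurveDeriv_eq {m : ℕ} (f : Fin m → ℝ → ℝ) (x : ℝ) :
    liftedCurveDeriv f x = vecCons 0 (vecCons 1 fun i => deriv (f i) x) := by
  ext k
  refine Fin.cases ?_ (fun k => Fin.cases ?_ (fun i => ?_) k) k
  · show deriv (fun _ => (1 : ℝ)) x = 0; simp
  · show deriv (fun x : ℝ => x) x = 1; simp
  · rfl

open Matrix in
lemma liftedCurve_eq {m : ℕ} (f : Fin m → ℝ → ℝ) (x : ℝ) :
    (fun k => liftedCurve f k x) = vecCons 1 (vecCons x fun i => f i x) := by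
  ext k
  refine Fin.cases ?_ (fun k => Fin.cases ?_ (fun i => ?_) k) k <;> rfl

open Matrix in
/-- The minors of `G(x) Γ` as bordered determinants. -/
lemma abs_minorFn_eq {m r : ℕ} (f : Fin m → ℝ → ℝ) (I : Fin r ↪o Fin (m + 2))
    (Γ : Matrix (Fin (m + 2)) (Fin r) ℤ) (x : ℝ) :
    |minorFn f I Γ x| = |borderedDet (selectionMatrix ℝ I * Γ.map (Int.cast : ℤ → ℝ))
      (selectionMatrix ℝ I *ᵥ (fun k => liftedCurve f k x) + tailIndicator I 1)
      (selectionMatrix ℝ I *ᵥ liftedCurveDeriv f x - tailIndicator I 0)| := by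
  set Δ := Γ.map (Int.cast : ℤ → ℝ) with hΔ
  let A : Matrix (Fin 2) (Fin 2) ℝ := !![1, 0; x, 1]
  let A' : Matrix (Fin 2) (Fin 2) ℝ := !![1, 0; -x, 1]
  have hAA' : A' * A = 1 := by simp [A, A', Matrix.one_fin_two]
  have hA'A : A * A' = 1 := by simp [A, A', Matrix.one_fin_two]
  let : Invertible A := ⟨A', hAA', hA'A⟩
  let y := selectionMatrix ℝ I *ᵥ (fun k => liftedCurve f k x) + tailIndicator I 1
  let z := selectionMatrix ℝ I *ᵥ liftedCurveDeriv f x - tailIndicator I 0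
  let C : Matrix (Fin r) (Fin 2) ℝ := of fun k => ![y (Sum.inr k), z (Sum.inr k)]
  let Pr : Matrix (Fin 2) (Fin (m + 2)) ℝ := of ![Pi.single 0 1, Pi.single 1 1]
  let E : Matrix (Fin r) (Fin (m + 2)) ℝ := of fun k =>
    Fin.append (fun i : Fin m => Pi.single i.succ.succ 1) (fun _ : Fin 2 => 0) (I k)
  have hblocks : fromCols (of ![y, z])ᵀ (selectionMatrix ℝ I * Δ) =
      fromBlocks A (Pr * Δ) C (E * Δ) := by
    obtain ⟨h1, h2⟩ := selectionMatrix_mulVec_inl I (fun k => liftedCurve f k x)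
    obtain ⟨h3, h4⟩ := selectionMatrix_mulVec_inl I (liftedCurveDeriv f x)
    rw [liftedCurve_eq] at h1 h2
    rw [liftedCurveDeriv_eq] at h3 h4
    ext p j
    rcases p with p | p <;> rcases j with j | j
    · fin_cases p <;> fin_cases j
      · simp [y, A, h1, tailIndicator, liftedCurve_eq]; rfl
      · simp [z, A, h3, tailIndicator, liftedCurveDeriv_eq]
      · simp [y, A, h2, tailIndicator, liftedCurve_eq]; rfl
      · simp [z, A, h4, tailIndicator, liftedCurveDeriv_eq]
    · rfl
    · fin_cases j <;> rfl
    · rfl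
  -- The Schur complement of the unipotent block `A` is `-G_I`. The tail indicators put `(0, -1)`
  -- and `(1, 0)` in the first two columns of rows `m` and `m + 1`, producing `(x, -1, 0, …)` and
  -- `(1, 0, 0, …)`.
  have hG : E - C * A' * Pr = -(gMatrix f x).submatrix I id := by
    ext k j
    have hC : (C * A' * Pr) k j = (y (Sum.inr k) - x * z (Sum.inr k)) *
        (Pi.single 0 1 : Fin (m + 2) → ℝ) j +
        z (Sum.inr k) * (Pi.single 1 1 : Fin (m + 2) → ℝ) j := by
      simp only [Matrix.mul_apply, Fin.sum_univ_two, C, A', Pr, of_apply, cons_val_zero,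
        cons_val_one, cons_val']
      simp
      left
      ring
    rw [Matrix.sub_apply, hC, Matrix.neg_apply, submatrix_apply, id]
    have hE : E k j = (Fin.append (fun i : Fin m => Pi.single i.succ.succ 1)
      (fun _ : Fin 2 => 0) (I k) : Fin (m + 2) → ℝ) j := rfl
    rw [hE]
    obtain ⟨i, hi⟩ | ⟨i, hi⟩ : (∃ i : Fin m, I k = Fin.castAdd 2 i) ∨
        ∃ i : Fin 2, I k = Fin.natAdd m i := by
      refine Fin.addCases (fun i => Or.inl ⟨i, rfl⟩) (fun i => Or.inr ⟨i, rfl⟩) (I k)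
    · have hy : y (Sum.inr k) = f i x := by
        simp only [y, Pi.add_apply]
        rw [selectionMatrix_mulVec_castAdd hi]
        have hf : liftedCurve f i.succ.succ x = f i x := rfl
        rw [hf]
        simp [tailIndicator, hi, Fin.ext_iff]
        omega
      have hz : z (Sum.inr k) = deriv (f i) x := by
        simp only [z, Pi.sub_apply]
        rw [selectionMatrix_mulVec_castAdd hi, liftedCurveDeriv_eq]
        simp [tailIndicator, hi, Fin.ext_iff]
        omega
      rw [hi, hy, hz, gMatrix, of_apply, Fin.append_left, Fin.append_left]
      refine Fin.cases ?_ (fun j => Fin.cases ?_ (fun j => ?_) j) j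
      · simp
      · simp [Fin.ext_iff]
      · simp [Pi.single_apply, Fin.ext_iff]
        split_ifs <;> simp
    · have hy : y (Sum.inr k) = if i = 1 then 1 else 0 := by
        simp only [y, Pi.add_apply]
        rw [selectionMatrix_mulVec_natAdd hi]
        simp [tailIndicator, hi]
      have hz : z (Sum.inr k) = if i = 0 then -1 else 0 := by
        simp only [z, Pi.sub_apply]
        rw [selectionMatrix_mulVec_natAdd hi]
        simp [tailIndicator, hi, apply_ite]
      rw [hi, hy, hz, gMatrix, of_apply, Fin.append_right, Fin.append_right]
      fin_cases i
      · refine Fin.cases ?_ (fun j => Fin.cases ?_ (fun j => ?_) j) j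
        · simp
        · simp
        · simp [Fin.ext_iff]
      · refine Fin.cases ?_ (fun j => Fin.cases ?_ (fun j => ?_) j) j <;> simp
  have hdetA : A.det = 1 := by simp [A, det_fin_two]
  have hinv : ⅟A = A' := rfl
  show |((gMatrix f x).submatrix I id * Δ).det| =
    |(fromCols (of ![y, z])ᵀ (selectionMatrix ℝ I * Δ)).det|
  rw [hblocks, det_fromBlocks₁₁, hdetA, one_mul, hinv]
  have : E * Δ - C * A' * (Pr * Δ) = -((gMatrix f x).submatrix I id * Δ) := by
    rw [← Matrix.mul_assoc, ← Matrix.sub_mul, hG, Matrix.neg_mul]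
  rw [this, det_neg, abs_mul]
  simp

open Matrix in
lemma linComb_vecMul {ρ ι : Type*} [Fintype ρ] [Fintype ι] (F : ι → ℝ → ℝ) (S : Matrix ρ ι ℝ)
    (α : ρ → ℝ) (x : ℝ) : linComb F (α ᵥ* S) x = α ⬝ᵥ (S *ᵥ fun k => F k x) :=
  (dotProduct_mulVec α S fun k => F k x).symm

open Matrix in
lemma linCombDeriv_vecMul {m : ℕ} {ρ : Type*} [Fintype ρ] (f : Fin m → ℝ → ℝ)
    (S : Matrix ρ (Fin (m + 2)) ℝ) (α : ρ → ℝ) (x : ℝ) :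
    linCombDeriv (liftedCurve f) (α ᵥ* S) x = α ⬝ᵥ (S *ᵥ liftedCurveDeriv f x) :=
  (dotProduct_mulVec α S (liftedCurveDeriv f x)).symm

lemma linComb_liftedCurve_single {m : ℕ} (f : Fin m → ℝ → ℝ) (t x : ℝ) :
    linComb (liftedCurve f) (Pi.single 0 t) x = t := by
  simp [linComb, Pi.single_apply, liftedCurve]

lemma linCombDeriv_liftedCurve_single {m : ℕ} (f : Fin m → ℝ → ℝ) (t x : ℝ) :
    linCombDeriv (liftedCurve f) (Pi.single 0 t) x = 0 := by
  have : deriv (liftedCurve f 0) x = 0 := by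
    show deriv (fun _ => (1 : ℝ)) x = 0
    simp
  simp [linCombDeriv, Pi.single_apply, this]

lemma tailIndicator_eq_zero {m r : ℕ} {I : Fin r → Fin (m + 2)} {i : Fin 2}
    (h : ∀ k, I k ≠ Fin.natAdd m i) : tailIndicator I i = 0 := by
  ext p
  rcases p with p | k
  · rfl
  · simp [tailIndicator, h k]

section representation

variable {m r : ℕ} (f : Fin m → ℝ → ℝ) (I : Fin r ↪o Fin (m + 2))
  (Γ : Matrix (Fin (m + 2)) (Fin r) ℤ) {α β : Fin 2 ⊕ Fin r → ℝ}

open Matrix in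
/-- The minors with rows among the first `m` are Wronskians. -/
lemma abs_minorFn_eq_wronskianComb
    (hαβ : ∀ y z, borderedDet (selectionMatrix ℝ I * Γ.map (Int.cast : ℤ → ℝ)) y z =
      (α ⬝ᵥ y) * (β ⬝ᵥ z) - (α ⬝ᵥ z) * (β ⬝ᵥ y))
    (h0 : ∀ k, I k ≠ Fin.natAdd m 0) (h1 : ∀ k, I k ≠ Fin.natAdd m 1) (x : ℝ) :
    |minorFn f I Γ x| = |wronskianComb (liftedCurve f) (α ᵥ* selectionMatrix ℝ I)
      (β ᵥ* selectionMatrix ℝ I) x| := by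
  rw [abs_minorFn_eq, tailIndicator_eq_zero h0, tailIndicator_eq_zero h1, add_zero, sub_zero, hαβ,
    wronskianComb, linComb_vecMul, linComb_vecMul, linCombDeriv_vecMul, linCombDeriv_vecMul]

open Matrix in
/-- The minors containing the row `(x, -1, 0, …, 0)` are linear combinations of the components of
the lifted curve. -/
lemma abs_minorFn_eq_linComb
    (hαβ : ∀ y z, borderedDet (selectionMatrix ℝ I * Γ.map (Int.cast : ℤ → ℝ)) y z =
      (α ⬝ᵥ y) * (β ⬝ᵥ z) - (α ⬝ᵥ z) * (β ⬝ᵥ y))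
    {p : Fin r} (hp : I p = Fin.natAdd m 0) (x : ℝ) :
    |minorFn f I Γ x| = |linComb (liftedCurve f)
      ((α (Sum.inr p) • β - β (Sum.inr p) • α) ᵥ* selectionMatrix ℝ I +
        Pi.single 0 ((α (Sum.inr p) • β - β (Sum.inr p) • α) ⬝ᵥ tailIndicator I 1)) x| := by
  rw [abs_minorFn_eq, linComb_add, linComb_vecMul, linComb_liftedCurve_single, ← dotProduct_add]
  set c₁ := selectionMatrix ℝ I *ᵥ (fun k => liftedCurve f k x) + tailIndicator I 1 with hc₁
  set c₂ := selectionMatrix ℝ I *ᵥ liftedCurveDeriv f x - tailIndicator I 0 with hc₂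
  -- Row `p` of `K` and of `c₁` is zero, and `c₂` has `-1` there. Adding the unit vector `e_p` to
  -- `c₂` therefore kills the determinant, so `c₂` may be replaced by `-e_p`, leaving a form linear
  -- in `c₁`.
  have hz : borderedDet (selectionMatrix ℝ I * Γ.map (Int.cast : ℤ → ℝ)) c₁
      (c₂ + Pi.single (Sum.inr p) 1) = 0 := by
    refine borderedDet_eq_zero_of_row (Sum.inr p) (selectionMatrix_mul_natAdd hp _) ?_ ?_
    · rw [hc₁, Pi.add_apply, selectionMatrix_mulVec_natAdd hp]
      simp [tailIndicator, hp]
    · rw [hc₂, Pi.add_apply, Pi.sub_apply, selectionMatrix_mulVec_natAdd hp]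
      simp [tailIndicator, hp]
  rw [hαβ] at hz ⊢
  congr 1
  simp only [dotProduct_add, dotProduct_single, mul_one, sub_dotProduct, smul_dotProduct,
    smul_eq_mul] at hz ⊢
  linarith

open Matrix in
/-- The minors containing the last row, but not the preceding one, are derivatives of linear
combinations of the components of the lifted curve. -/
lemma abs_minorFn_eq_wronskianComb_single
    (hαβ : ∀ y z, borderedDet (selectionMatrix ℝ I * Γ.map (Int.cast : ℤ → ℝ)) y z =
      (α ⬝ᵥ y) * (β ⬝ᵥ z) - (α ⬝ᵥ z) * (β ⬝ᵥ y))
    (h0 : ∀ k, I k ≠ Fin.natAdd m 0) {p : Fin r} (hp : I p = Fin.natAdd m 1) (x : ℝ) :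
    |minorFn f I Γ x| = |wronskianComb (liftedCurve f) (Pi.single 0 1)
      ((α (Sum.inr p) • β - β (Sum.inr p) • α) ᵥ* selectionMatrix ℝ I) x| := by
  rw [abs_minorFn_eq, wronskianComb, linComb_liftedCurve_single, linCombDeriv_liftedCurve_single,
    linCombDeriv_vecMul, tailIndicator_eq_zero h0, sub_zero]
  set c₁ := selectionMatrix ℝ I *ᵥ (fun k => liftedCurve f k x) + tailIndicator I 1 with hc₁
  set c₂ := selectionMatrix ℝ I *ᵥ liftedCurveDeriv f x with hc₂
  -- Here it is `c₁` that has entry `1` in row `p` and may be replaced by the unit vector `e_p`.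
  -- What remains is the derivative of a combination, i.e. its Wronskian with the constant `1`.
  have hz : borderedDet (selectionMatrix ℝ I * Γ.map (Int.cast : ℤ → ℝ))
      (c₁ - Pi.single (Sum.inr p) 1) c₂ = 0 := by
    refine borderedDet_eq_zero_of_row (Sum.inr p) (selectionMatrix_mul_natAdd hp _) ?_ ?_
    · rw [hc₁, Pi.sub_apply, Pi.add_apply, selectionMatrix_mulVec_natAdd hp]
      simp [tailIndicator, hp]
    · rw [hc₂, selectionMatrix_mulVec_natAdd hp]
  rw [hαβ] at hz ⊢
  congr 1
  simp only [dotProduct_sub, dotProduct_single, mul_one, sub_dotProduct, smul_dotProduct,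
    smul_eq_mul] at hz ⊢
  linarith

/-- Every minor is, up to sign, a linear combination of the components of the lifted curve or a
Wronskian of two of them. -/
lemma exists_abs_minorFn_eq :
    (∃ a, ∀ x, |minorFn f I Γ x| = |linComb (liftedCurve f) a x|) ∨
      ∃ a b, ∀ x, |minorFn f I Γ x| = |wronskianComb (liftedCurve f) a b x| := by
  obtain ⟨α, β, hαβ⟩ := exists_borderedDet_eq
    (selectionMatrix ℝ I * Γ.map (Int.cast : ℤ → ℝ))
  by_cases h0 : ∃ p, I p = Fin.natAdd m 0
  · obtain ⟨p, hp⟩ := h0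
    exact Or.inl ⟨_, abs_minorFn_eq_linComb f I Γ hαβ hp⟩
  push Not at h0
  by_cases h1 : ∃ p, I p = Fin.natAdd m 1
  · obtain ⟨p, hp⟩ := h1
    exact Or.inr ⟨_, _, abs_minorFn_eq_wronskianComb_single f I Γ hαβ h0 hp⟩
  push Not at h1
  exact Or.inr ⟨_, _, abs_minorFn_eq_wronskianComb f I Γ hαβ h0 h1⟩

end representation

/-! ### Choosing rows so that integrality gives a large coefficient -/

open Matrix in
lemma HasFullColumnRank.eq_zero_of_mulVec {k r : ℕ} {Γ : Matrix (Fin k) (Fin r) ℤ}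
    (hΓ : HasFullColumnRank Γ) (v : Fin r → ℝ) (hv : Γ.map (Int.cast : ℤ → ℝ) *ᵥ v = 0) :
    v = 0 := by
  have h1 := LinearMap.finrank_range_add_finrank_ker (Γ.map (Int.cast : ℤ → ℝ)).mulVecLin
  have h2 : Module.finrank ℝ (LinearMap.range (Γ.map (Int.cast : ℤ → ℝ)).mulVecLin) = r := hΓ
  rw [h2, Module.finrank_fin_fun] at h1
  have h3 : LinearMap.ker (Γ.map (Int.cast : ℤ → ℝ)).mulVecLin = ⊥ :=
    Submodule.finrank_eq_zero.1 (by omega)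
  exact LinearMap.ker_eq_bot'.1 h3 v hv

open Matrix in
/-- A matrix with `r` columns has at most `r` rows that determine its kernel. -/
lemma exists_finset_rows_ker {k r : ℕ} (Δ : Matrix (Fin k) (Fin r) ℝ) :
    ∃ J : Finset (Fin k), J.card ≤ r ∧ ∀ v, (∀ j ∈ J, (Δ *ᵥ v) j = 0) → Δ *ᵥ v = 0 := by
  obtain ⟨κ, a, ha, hspan, hli⟩ := exists_linearIndependent' ℝ (fun i => Δ i)
  have : Finite κ := Finite.of_injective a ha
  have : Fintype κ := Fintype.ofFinite κ
  refine ⟨Finset.univ.map ⟨a, ha⟩, ?_, fun v hv => ?_⟩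
  · have := hli.fintype_card_le_finrank
    simpa using this
  · have hle : Submodule.span ℝ (Set.range fun i => Δ i) ≤
        LinearMap.ker ((dotProductBilin ℝ ℝ).flip v) := by
      rw [← hspan, Submodule.span_le]
      rintro _ ⟨j, rfl⟩
      exact hv (a j) (Finset.mem_map_of_mem _ (Finset.mem_univ j))
    ext i
    exact hle (Submodule.subset_span ⟨i, rfl⟩)

open Matrix in
/-- For `r ≤ m` there are `r` indices among the first `m` such that the selected rows of `Γ` still
have rank `r`. -/
lemma exists_selection {m r : ℕ} (hr : r ≤ m) {Γ : Matrix (Fin (m + 2)) (Fin r) ℤ}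
    (hΓ : HasFullColumnRank Γ) :
    ∃ I : Fin r ↪o Fin (m + 2), (∀ k, (I k : ℕ) < m) ∧
      ∀ v, (selectionMatrix ℝ I * Γ.map (Int.cast : ℤ → ℝ)) *ᵥ v = 0 → v = 0 := by
  obtain ⟨J, hJ, hker⟩ := exists_finset_rows_ker (Γ.map (Int.cast : ℤ → ℝ))
  let ss : Fin m ↪ Fin (m + 2) := ⟨fun i => i.succ.succ, fun i j h => by simpa using h⟩
  set J' : Finset (Fin m) := Finset.univ.filter fun i => ss i ∈ J with hJ'
  have hcard : J'.card ≤ r := by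
    rw [← Finset.card_map ss]
    refine (Finset.card_le_card fun j hj => ?_).trans hJ
    obtain ⟨i, hi, rfl⟩ := Finset.mem_map.1 hj
    exact (Finset.mem_filter.1 hi).2
  -- Rows `0` and `1` of `Γ` are always selected, so only the others need to be covered by `I`; `r ≤
  -- m` leaves room to pad to exactly `r` indices.
  obtain ⟨T, hJT, hT⟩ := Finset.exists_superset_card_eq hcard (by simpa using hr)
  refine ⟨(T.orderEmbOfFin hT).trans (Fin.castAddOrderEmb 2), fun k => ?_, fun v hv => ?_⟩
  · simp
  · refine hΓ.eq_zero_of_mulVec v (hker v fun j hj => ?_)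
    rw [← mulVec_mulVec] at hv
    revert hj
    refine Fin.cases (fun _ => ?_) (fun j => Fin.cases (fun _ => ?_) (fun i hi => ?_) j) j
    · exact (selectionMatrix_mulVec_inl _ _).1.symm.trans (by rw [hv]; rfl)
    · exact (selectionMatrix_mulVec_inl _ _).2.symm.trans (by rw [hv]; rfl)
    · have hiT : i ∈ T := hJT (Finset.mem_filter.2 ⟨Finset.mem_univ _, hi⟩)
      obtain ⟨k, hk⟩ : ∃ k, T.orderEmbOfFin hT k = i := by
        have : i ∈ Set.range (T.orderEmbOfFin hT) := by
          rw [Finset.range_orderEmbOfFin]; exact hiT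
        exact this
      exact (selectionMatrix_mulVec_castAdd (R := ℝ)
        (I := (T.orderEmbOfFin hT).trans (Fin.castAddOrderEmb 2)) (k := k) (i := i)
        (by simp [hk]) _).symm.trans (by rw [hv]; rfl)

open Matrix in
lemma selectionMatrix_mul_map {m r : ℕ} (I : Fin r → Fin (m + 2))
    (Γ : Matrix (Fin (m + 2)) (Fin r) ℤ) :
    (selectionMatrix ℤ I * Γ).map (Int.cast : ℤ → ℝ) =
      selectionMatrix ℝ I * Γ.map (Int.cast : ℤ → ℝ) := by
  rw [← selectionMatrix_map]
  exact Matrix.map_mul (f := Int.castRingHom ℝ)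

open Matrix in
/-- For `r ≤ m`, some minor with rows among the first `m` is a Wronskian with a large
coefficient. -/
lemma exists_minorFn_wronskianComb {m r : ℕ} (f : Fin m → ℝ → ℝ) (hr : r ≤ m)
    {Γ : Matrix (Fin (m + 2)) (Fin r) ℤ} (hΓ : HasFullColumnRank Γ) :
    ∃ I : Fin r ↪o Fin (m + 2), (∀ k, (I k : ℕ) < m) ∧ ∃ a b : Fin (m + 2) → ℝ,
      (∀ x, |minorFn f I Γ x| = |wronskianComb (liftedCurve f) a b x|) ∧
      ∃ i j, 1 ≤ |a i * b j - a j * b i| := by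
  obtain ⟨I, hI, hker⟩ := exists_selection hr hΓ
  refine ⟨I, hI, ?_⟩
  obtain ⟨α, β, hαβ⟩ := exists_borderedDet_eq (selectionMatrix ℝ I * Γ.map (Int.cast : ℤ → ℝ))
  obtain ⟨p, q, hpq⟩ := exists_one_le_abs_coord (K := selectionMatrix ℤ I * Γ)
    (by simpa only [selectionMatrix_mul_map] using hker)
    (by simpa only [selectionMatrix_mul_map] using hαβ)
  obtain ⟨i, hi⟩ := exists_vecMul_selectionMatrix_eq I.injective (p := p) fun k _ => hI k
  obtain ⟨j, hj⟩ := exists_vecMul_selectionMatrix_eq I.injective (p := q) fun k _ => hI k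
  refine ⟨_, _, abs_minorFn_eq_wronskianComb f I Γ hαβ ?_ ?_, i, j, ?_⟩
  · intro k h; have := hI k; rw [h] at this; simp at this
  · intro k h; have := hI k; rw [h] at this; simp at this
  · rwa [hi, hi, hj, hj]

open Matrix in
/-- For `r = m + 1`, the minor with the first `m + 1` rows is a linear combination with a large
coefficient. -/
lemma exists_minorFn_linComb {m : ℕ} (f : Fin m → ℝ → ℝ)
    {Γ : Matrix (Fin (m + 2)) (Fin (m + 1)) ℤ} (hΓ : HasFullColumnRank Γ) :
    ∃ I : Fin (m + 1) ↪o Fin (m + 2), (∀ k, (I k : ℕ) < m + 1) ∧ ∃ a : Fin (m + 2) → ℝ,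
      (∀ x, |minorFn f I Γ x| = |linComb (liftedCurve f) a x|) ∧ ∃ i, 1 ≤ |a i| := by
  let I : Fin (m + 1) ↪o Fin (m + 2) := Fin.castSuccOrderEmb
  refine ⟨I, fun k => by simpa [I] using k.is_lt, ?_⟩
  have hIlast : I (Fin.last m) = Fin.natAdd m 0 := by simp [I, Fin.ext_iff]
  have hI1 : ∀ k, I k ≠ Fin.natAdd m 1 := by
    intro k h
    have := congrArg Fin.val h
    simp [I] at this
    omega
  obtain ⟨α, β, hαβ⟩ := exists_borderedDet_eq (selectionMatrix ℝ I * Γ.map (Int.cast : ℤ → ℝ))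
  have hker : ∀ v, (selectionMatrix ℝ I * Γ.map (Int.cast : ℤ → ℝ)) *ᵥ v = 0 → v = 0 := by
    intro v hv
    refine hΓ.eq_zero_of_mulVec v ?_
    rw [← mulVec_mulVec] at hv
    ext j
    refine Fin.cases ?_ (fun j => Fin.cases ?_ (fun i => ?_) j) j
    · exact (selectionMatrix_mulVec_inl I _).1.symm.trans (by rw [hv]; rfl)
    · exact (selectionMatrix_mulVec_inl I _).2.symm.trans (by rw [hv]; rfl)
    · exact (selectionMatrix_mulVec_castAdd (R := ℝ) (I := I) (k := i.castSucc) (i := i)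
        (by simp [I, Fin.ext_iff]) _).symm.trans (by rw [hv]; rfl)
  obtain ⟨p, q, hpq⟩ := exists_one_le_abs_coord (K := selectionMatrix ℤ I * Γ)
    (by simpa only [selectionMatrix_mul_map] using hker)
    (by simpa only [selectionMatrix_mul_map] using hαβ)
  set v := α (Sum.inr (Fin.last m)) • β - β (Sum.inr (Fin.last m)) • α with hv
  -- Row `Fin.last m` of `K` is zero, so coordinates of the form avoiding that index vanish. A
  -- coordinate of size at least one thus involves it, and is up to sign an entry of `v`.
  have hlarge : ∃ q, q ≠ Sum.inr (Fin.last m) ∧ 1 ≤ |v q| := by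
    by_cases hp : p = Sum.inr (Fin.last m)
    · refine ⟨q, ?_, ?_⟩
      · rintro rfl
        rw [hp] at hpq; norm_num at hpq
      · rw [hp] at hpq
        simpa [hv, mul_comm] using hpq
    · by_cases hq : q = Sum.inr (Fin.last m)
      · refine ⟨p, hp, ?_⟩
        rw [hq, abs_sub_comm] at hpq
        simpa [hv, mul_comm] using hpq
      · have h0 := borderedDet_eq_zero_of_row (y := Pi.single p 1) (z := Pi.single q 1)
          (Sum.inr (Fin.last m))
          (selectionMatrix_mul_natAdd hIlast (Γ.map (Int.cast : ℤ → ℝ)))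
          (by simp [Ne.symm hp]) (by simp [Ne.symm hq])
        rw [hαβ] at h0
        simp only [dotProduct_single, mul_one] at h0
        rw [h0] at hpq
        norm_num at hpq
  obtain ⟨q, hq, hvq⟩ := hlarge
  refine ⟨_, abs_minorFn_eq_linComb f I Γ hαβ hIlast, ?_⟩
  obtain ⟨j, hj⟩ := exists_vecMul_selectionMatrix_eq I.injective (p := q) (by
    rintro k rfl
    have : k ≠ Fin.last m := fun h => hq (by rw [h])
    simpa [I] using Fin.val_lt_last this)
  refine ⟨j, ?_⟩
  rw [tailIndicator_eq_zero hI1, dotProduct_zero, Pi.single_zero, add_zero, hj]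
  exact hvq

/-! ### Assembly -/

lemma abs_minorFn_isGoodOn {m : ℕ} {f : Fin m → ℝ → ℝ} {V : Set ℝ} {ε M : ℝ} {l : ℕ} (hl : 1 ≤ l)
    (hM : (1 / 2) ^ (2 * l - 1) * M ≤ ε)
    (hc₁ : ∀ a, ContinuousOn (linComb (liftedCurve f) a) V)
    (hc₂ : ∀ a b, ContinuousOn (wronskianComb (liftedCurve f) a b) V)
    (h₁ : ∀ y s, 0 < s → ball y s ⊆ V → ∀ a, ∃ κ : ℝ, 0 ≤ κ ∧
      IsSpreadOn ε M κ (linComb (liftedCurve f) a) y s)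
    (h₂ : ∀ y s, 0 < s → ball y s ⊆ V → ∀ a b, ∃ κ : ℝ, 0 ≤ κ ∧
      IsSpreadOn ε M κ (wronskianComb (liftedCurve f) a b) y s)
    {r : ℕ} (I : Fin r ↪o Fin (m + 2)) (Γ : Matrix (Fin (m + 2)) (Fin r) ℤ) :
    IsGoodOn 2 (1 / (2 * (l : ℝ) - 1)) (fun x => |minorFn f I Γ x|) V := by
  obtain ⟨a, ha⟩ | ⟨a, b, hab⟩ := exists_abs_minorFn_eq f I Γ
  · refine isGoodOn_of_one_scale hl ?_ fun c s hs hV => ?_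
    · simp only [ha]
      exact (hc₁ a).abs
    · obtain ⟨κ, hκ, h⟩ := h₁ c s hs hV a
      exact (h.congr_abs (h := fun x => |minorFn f I Γ x|)
        fun x => by rw [abs_abs, ha]).volume_le hκ (by positivity) hM
  · refine isGoodOn_of_one_scale hl ?_ fun c s hs hV => ?_
    · simp only [hab]
      exact (hc₂ a b).abs
    · obtain ⟨κ, hκ, h⟩ := h₂ c s hs hV a b
      exact (h.congr_abs (h := fun x => |minorFn f I Γ x|)
        fun x => by rw [abs_abs, hab]).volume_le hκ (by positivity) hM

lemma ball_subset_ball_of_subset {c s x₀ δ lam : ℝ} (hs : 0 < s) (hδ : 0 < δ) (hlam : 0 ≤ lam)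
    (h : ball c s ⊆ ball x₀ δ) : ball c (lam * s) ⊆ ball x₀ ((lam + 1) * δ) := by
  have hsδ : s ≤ δ := by
    have h1 := measure_mono (μ := volume) h
    rw [Real.volume_ball, Real.volume_ball, ENNReal.ofReal_le_ofReal_iff (by positivity)] at h1
    linarith
  have hc : dist c x₀ < δ := h (mem_ball_self hs)
  refine ball_subset_ball' ?_
  nlinarith

/-- The ambient dimension is `n = m + 1 ≥ 2`; row indices are counted from zero. -/
theorem mainTheorem5 (m : ℕ) (hm : 1 ≤ m) (f : Fin m → ℝ → ℝ) (x₀ : ℝ)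
    (hf : IsNondegenerateAt (mongeCurve f) x₀) :
    ∃ (δ : ℝ) (l : ℕ) (C : ℝ), 0 < δ ∧ 1 ≤ l ∧ 0 < C ∧
      ∀ (B : Set ℝ) (c s : ℝ), 0 < s → IsIntervalAround B c s → B ⊆ Metric.ball x₀ δ →
        ∃ ρ : ℝ, 0 < ρ ∧
          ∀ (r : ℕ), 1 ≤ r → r ≤ m + 1 →
            ∀ Γ : Matrix (Fin (m + 2)) (Fin r) ℤ, HasFullColumnRank Γ →
              (∀ I : Fin r ↪o Fin (m + 2),
                IsGoodOn C (1 / (2 * (l : ℝ) - 1)) (fun x => |minorFn f I Γ x|)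
                  (Metric.ball c (3 ^ (m + 2) * s))) ∧
              (∃ I : Fin r ↪o Fin (m + 2), (∀ k : Fin r, (I k : ℕ) < max r m) ∧
                ENNReal.ofReal ρ ≤ supAbs (fun x => |minorFn f I Γ x|) B) := by
  obtain ⟨L', ⟨δ₀, hδ₀, hsm⟩, hspan⟩ := hf
  obtain ⟨L, rfl⟩ : ∃ L, L' = L + 1 := by
    refine Nat.exists_eq_succ_of_ne_zero ?_
    rintro rfl
    have h0 : {v : Fin (m + 1) → ℝ | ∃ i : ℕ, 1 ≤ i ∧ i ≤ 0 ∧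
        v = iteratedDeriv i (mongeCurve f) x₀} = ∅ := by
      ext v
      simp only [Set.mem_ofPred_eq, Set.mem_empty_iff_false, iff_false]
      rintro ⟨i, h1, h2, -⟩
      omega
    rw [h0, Submodule.span_empty] at hspan
    exact bot_ne_top hspan
  have hF := contDiffOn_liftedCurve hsm
  obtain ⟨δ₁, ε, M, hδ₁, hδ₁₀, hε, hM, R, hR, H⟩ := exists_isSpreadOn hδ₀ hF
    fun a ha => eq_zero_of_sum_mul_iteratedDeriv_eq_zero hδ₀ hsm hspan a ha
  -- The integer `l` is dictated by the ratio `ε / M`: the one-scale argument needs `(1 / 2) ^ (2 *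
  -- l - 1) * M ≤ ε`.
  obtain ⟨l₀, hl₀⟩ := exists_pow_lt_of_lt_one (div_pos hε hM) (by norm_num : (1 / 2 : ℝ) < 1)
  have hl : (1 / 2 : ℝ) ^ (2 * (l₀ + 1) - 1) * M ≤ ε := by
    rw [← le_div_iff₀ hM]
    exact (pow_le_pow_of_le_one (by norm_num) (by norm_num) (by omega)).trans hl₀.le
  have hδ0 : (0 : ℝ) < 3 ^ (m + 2) + 1 := by positivity
  -- The centre and half-length of `B` both contribute at most this radius, so the `3 ^ (m +
  -- 2)`-fold dilate stays in the ball of radius `δ₁`; here `m + 2 = n + 1`.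
  refine ⟨δ₁ / (3 ^ (m + 2) + 1), l₀ + 1, 2, by positivity, by omega, two_pos, ?_⟩
  intro B c s hs hB hBδ
  have hball : ball c s ⊆ ball x₀ (δ₁ / (3 ^ (m + 2) + 1)) := hB.1.trans hBδ
  have hV : ball c (3 ^ (m + 2) * s) ⊆ ball x₀ δ₁ := by
    have := ball_subset_ball_of_subset (lam := 3 ^ (m + 2)) hs (by positivity) (by positivity) hball
    rwa [mul_div_cancel₀ _ hδ0.ne'] at this
  have hcs : ball c s ⊆ ball x₀ δ₁ := hball.trans (ball_subset_ball
    (div_le_self hδ₁.le (by linarith [pow_pos (three_pos (α := ℝ)) (m + 2)])))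
  have hV₀ : ball c (3 ^ (m + 2) * s) ⊆ ball x₀ δ₀ := hV.trans (ball_subset_ball hδ₁₀)
  have hRs := hR s hs
  have hlarge : ∀ {r : ℕ} (I : Fin r ↪o Fin (m + 2)) (Γ : Matrix (Fin (m + 2)) (Fin r) ℤ)
      (g : ℝ → ℝ) (κ t : ℝ), IsSpreadOn ε M κ g c s → (∀ x, |minorFn f I Γ x| = |g x|) →
      1 ≤ t → t ≤ κ * R s →
      ENNReal.ofReal (ε / R s) ≤ supAbs (fun x => |minorFn f I Γ x|) B := by
    intro r I Γ g κ t hg hIg ht htκ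
    have h1 := (hg.congr_abs (h := fun x => |minorFn f I Γ x|)
      fun x => by rw [abs_abs, hIg]).le_supAbs hs
    refine le_trans (ENNReal.ofReal_le_ofReal ?_) (h1.trans (supAbs_mono hB.1))
    rw [div_le_iff₀ hRs, mul_assoc]
    nlinarith
  -- A coefficient quantity at least one forces `κ ≥ 1 / R s`, and the supremum is at least `ε * κ`;
  -- `R` depends neither on `Γ` nor on `r`.
  refine ⟨ε / R s, by positivity, fun r _ hr Γ hΓ => ⟨fun I => ?_, ?_⟩⟩
  · refine abs_minorFn_isGoodOn (by omega) hl (fun a => continuousOn_linComb hV₀ hF a)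
      (fun a b => continuousOn_wronskianComb isOpen_ball hV₀ hF a b) ?_ ?_ I Γ
    · intro y t ht hyt a
      obtain ⟨κ, hκ, h, -⟩ := (H y t ht (hyt.trans hV)).1 a
      exact ⟨κ, hκ, h⟩
    · intro y t ht hyt a b
      obtain ⟨κ, hκ, h, -⟩ := (H y t ht (hyt.trans hV)).2 a b
      exact ⟨κ, hκ, h⟩
  · rcases Nat.lt_or_ge m r with hmr | hrm
    · obtain rfl : r = m + 1 := by omega
      obtain ⟨I, hI, a, ha, i, hi⟩ := exists_minorFn_linComb f hΓ
      obtain ⟨κ, -, h, hκ⟩ := (H c s hs hcs).1 a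
      exact ⟨I, fun k => (hI k).trans_le (le_max_left _ _),
        hlarge I Γ _ κ _ h ha hi (hκ i)⟩
    · obtain ⟨I, hI, a, b, hab, i, j, hij⟩ := exists_minorFn_wronskianComb f hrm hΓ
      obtain ⟨κ, -, h, hκ⟩ := (H c s hs hcs).2 a b
      exact ⟨I, fun k => (hI k).trans_le (le_max_right _ _),
        hlarge I Γ _ κ _ h hab hij (hκ i j)⟩
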